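/- **Setting.** All systems are finite-dimensional with a fixed orthonormal (incoherent) basis; composite systems carry the product basis. A state is incoherent if its density matrix is diagonal in this basis; the set of incoherent states is $\mathcal I$. An incoherent operation $\Phi$ (possibly between different systems) is a map $\Phi(\rho)=\sum_n K_n\rho K_n^\dagger$ with finitely many Kraus operators satisfying $\sum_n K_n^\dagger K_n=\mathbb 1$ and such that each $K_n$ maps diagonal density matrices to diagonal matrices (such $\{K_n\}$ are called incoherent Kraus operators). For a state $\rho$ with eigenvalues $\lambda_i$ and orthonormal eigenvectors $|i\rangle$, and a Hermitian $H$, the quantum Fisher information is $$\mathcal F(\rho,H)=2\sum_{i,j:\ \lambda_i+\lambda_j\neq 0}\frac{(\lambda_i-\lambda_j)^2}{\lambda_i+\lambda_j}\,|\langle i|H|j\rangle|^2 .$$ Let $M,N\ge 1$. For $1\le k\le M$, $1\le j\le N$ let $h^{(k,j)}$ be a Hermitian operator on a finite-dimensional particle space that is not a multiple of the identity; the incoherent basis of that particle is a chosen orthonormal eigenbasis of $h^{(k,j)}$. Put $H_S^{(k)}=\sum_{j=1}^N h^{(k,j)}$, where $h^{(k,j)}$ acts on the $j$th particle of the $k$th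 partition. For a pure state $|\psi\rangle$ of any finite-dimensional system define $$\mathcal C_F^M(|\psi\rangle)=\sup_{\Phi}\ \sum_{k=1}^M \mathcal F\big(\mathrm{Tr}_{P(k)^c}[\Phi(|\psi\rangle\langle\psi|)],\,H_S^{(k)}\big),$$ where $\Phi$ ranges over all incoherent operations whose output system consists of $M$ partitions $P(1),\dots,P(M)$, the partition $P(k)$ consisting of the $N$ particles on which $H_S^{(k)}$ acts and of an arbitrary finite-dimensional ancilla on which it acts trivially, and $\mathrm{Tr}_{P(k)^c}$ traces out all partitions except $P(k)$. For an arbitrary state $\rho$ define the convex roof $$\mathcal C_F^M(\rho)=\inf\ \sum_i p_i\,\mathcal C_F^M(|\psi_i\rangle)$$ over all finite pure state decompositions $\rho=\sum_i p_i|\psi_i\rangle\langle\psi_i|$. **Theorem.** For all $M,N\ge 1$ and all $h^{(k,j)}$ as above, the supremum and the infimum are over non-empty sets of real numbers that are bounded above and below, respectively, so that $\mathcal C_F^M$ is a well-defined real-valued function, and $\mathcal C_F^M$ is a coherence measure: 1. (Faithfulness) $\mathcal C_F^M(\rho)\ge 0$ for every state $\rho$, with equality if and only if $\rho\in\mathcal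 I$. 2. (Monotonicity) $\mathcal C_F^M(\Phi(\rho))\le \mathcal C_F^M(\rho)$ for every state $\rho$ and every incoherent operation $\Phi$. 3. (Strong monotonicity) For every state $\rho$ and all incoherent Kraus operators $\{K_n\}$, $\sum_{n:\,p_n>0} p_n\,\mathcal C_F^M(\rho_n)\le \mathcal C_F^M(\rho)$, where $p_n=\mathrm{Tr}[K_n\rho K_n^\dagger]$ and $\rho_n=K_n\rho K_n^\dagger/p_n$. 4. (Convexity) $\mathcal C_F^M(\lambda\rho+(1-\lambda)\sigma)\le\lambda\,\mathcal C_F^M(\rho)+(1-\lambda)\,\mathcal C_F^M(\sigma)$ for all states $\rho,\sigma$ of the same system and $0\le\lambda\le 1$. -/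

import Mathlib

open scoped Matrix Kronecker ComplexOrder

noncomputable section

namespace CoherenceQFI

/-! Finite-dimensional systems are given by a finite index set `ι` labelling the fixed incoherent
orthonormal basis; operators are matrices in that basis. -/

/-- Density matrices: positive semidefinite with unit trace. -/
def IsDensity {ι : Type} [Fintype ι] (ρ : Matrix ι ι ℂ) : Prop :=
  ρ.PosSemidef ∧ ρ.trace = 1

/-- Incoherent states: density matrices that are diagonal in the fixed basis. -/
def IsIncoherentState {ι : Type} [Fintype ι] (ρ : Matrix ι ι ℂ) : Prop :=
  IsDensity ρ ∧ ρ.IsDiag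

/-- A normalized state vector. -/
def IsUnitVector {ι : Type} [Fintype ι] (ψ : ι → ℂ) : Prop :=
  ∑ i, ‖ψ i‖ ^ 2 = 1

/-- The rank-one projector `|ψ⟩⟨ψ|`. -/
def pureState {ι : Type} (ψ : ι → ℂ) : Matrix ι ι ℂ :=
  Matrix.vecMulVec ψ (star ψ)

/-- A complete set of incoherent Kraus operators: `∑ₙ Kₙ† Kₙ = 1`, and each `Kₙ` maps every
incoherent state to an (unnormalized) incoherent state. -/
def IsIncoherentKraus {ι κ : Type} [Fintype ι] [DecidableEq ι] [Fintype κ] {r : ℕ}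
    (K : Fin r → Matrix κ ι ℂ) : Prop :=
  ∑ n, (K n)ᴴ * K n = 1 ∧
    ∀ n, ∀ σ : Matrix ι ι ℂ, IsIncoherentState σ → (K n * σ * (K n)ᴴ).IsDiag

/-- Incoherent completely positive trace preserving maps (from a system with basis `ι` to a system
with basis `κ`): the maps `ρ ↦ ∑ₙ Kₙ ρ Kₙ†` with incoherent Kraus operators `Kₙ`. -/
def IsIncoherentOperation {ι κ : Type} [Fintype ι] [DecidableEq ι] [Fintype κ]
    (Φ : Matrix ι ι ℂ →ₗ[ℂ] Matrix κ κ ℂ) : Prop :=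
  ∃ (r : ℕ) (K : Fin r → Matrix κ ι ℂ), IsIncoherentKraus K ∧
    ∀ ρ, Φ ρ = ∑ n, K n * ρ * (K n)ᴴ

/-- The axioms of a coherence measure `C`, a real-valued function of the
states of every finite-dimensional system. -/
structure IsCoherenceMeasure
    (C : ∀ (ι : Type) [Fintype ι] [DecidableEq ι], Matrix ι ι ℂ → ℝ) : Prop where
  /-- Nonnegativity. -/
  nonneg : ∀ (ι : Type) [Fintype ι] [DecidableEq ι] (ρ : Matrix ι ι ℂ),
    IsDensity ρ → 0 ≤ C ι ρ
  /-- Faithfulness. -/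
  faithful : ∀ (ι : Type) [Fintype ι] [DecidableEq ι] (ρ : Matrix ι ι ℂ),
    IsDensity ρ → (C ι ρ = 0 ↔ IsIncoherentState ρ)
  /-- Monotonicity under incoherent operations. -/
  monotone : ∀ (ι κ : Type) [Fintype ι] [DecidableEq ι] [Fintype κ] [DecidableEq κ]
    (Φ : Matrix ι ι ℂ →ₗ[ℂ] Matrix κ κ ℂ) (ρ : Matrix ι ι ℂ),
    IsIncoherentOperation Φ → IsDensity ρ → C κ (Φ ρ) ≤ C ι ρ
  /-- Strong monotonicity: `∑ₙ pₙ C(ρₙ) ≤ C(ρ)` with `pₙ = Tr[Kₙ ρ Kₙ†]` and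
  `ρₙ = Kₙ ρ Kₙ† / pₙ`; outcomes with `pₙ = 0` contribute `0`. -/
  strongMonotone : ∀ (ι κ : Type) [Fintype ι] [DecidableEq ι] [Fintype κ] [DecidableEq κ]
    (r : ℕ) (K : Fin r → Matrix κ ι ℂ) (ρ : Matrix ι ι ℂ),
    IsIncoherentKraus K → IsDensity ρ →
      ∑ n, (K n * ρ * (K n)ᴴ).trace.re *
        C κ (((K n * ρ * (K n)ᴴ).trace.re)⁻¹ • (K n * ρ * (K n)ᴴ)) ≤ C ι ρ
  /-- Convexity. -/
  convex : ∀ (ι : Type) [Fintype ι] [DecidableEq ι] (ρ σ : Matrix ι ι ℂ) (t : ℝ),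
    IsDensity ρ → IsDensity σ → 0 ≤ t → t ≤ 1 →
      C ι (t • ρ + (1 - t) • σ) ≤ t * C ι ρ + (1 - t) * C ι σ

open Classical in
/-- Quantum Fisher information
`F(ρ, H) = 2 ∑_{i,j} (λᵢ - λⱼ)² / (λᵢ + λⱼ) |⟨i|H|j⟩|²`, where `λᵢ`, `|i⟩` are the eigenvalues and an
orthonormal eigenbasis of `ρ`. Terms with `λᵢ + λⱼ = 0` are omitted (they are `0` by `x / 0 = 0`).
The value at a non-Hermitian `ρ` is irrelevant. -/
def qfi {ι : Type} [Fintype ι] [DecidableEq ι] (ρ H : Matrix ι ι ℂ) : ℝ :=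
  if hρ : ρ.IsHermitian then
    2 * ∑ i, ∑ j, (hρ.eigenvalues i - hρ.eigenvalues j) ^ 2 /
      (hρ.eigenvalues i + hρ.eigenvalues j) *
        ‖inner ℂ (hρ.eigenvectorBasis i) (Matrix.toEuclideanLin H (hρ.eigenvectorBasis j))‖ ^ 2
  else 0

/-- Basis labels of the `N` particles, of dimensions `d 0, …, d (N - 1)`, probed in one
partition. -/
abbrev Particles {N : ℕ} (d : Fin N → ℕ) : Type := ∀ j : Fin N, Fin (d j)

/-- Basis labels of one partition: `N` particles that interact with the Hamiltonian, and ancillary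
particles of total dimension `a` that do not. -/
abbrev Partition {N : ℕ} (d : Fin N → ℕ) (a : ℕ) : Type := Particles d × Fin a

/-- Basis labels of the whole output system, consisting of `M` partitions. -/
abbrev Output {M N : ℕ} (d : Fin M → Fin N → ℕ) (a : Fin M → ℕ) : Type :=
  ∀ k : Fin M, Partition (d k) (a k)

/-- The operator acting as `h` on particle `j` and as the identity on all other particles. -/
def onParticle {N : ℕ} {d : Fin N → ℕ} (j : Fin N) (h : Matrix (Fin (d j)) (Fin (d j)) ℂ) :
    Matrix (Particles d) (Particles d) ℂ :=
  Matrix.of fun x y => if ∀ l, l ≠ j → x l = y l then h (x j) (y j) else 0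

/-- The local Hamiltonian `∑ⱼ h⁽ʲ⁾` on a partition; it acts trivially on the ancillas. -/
def localHamiltonian {N : ℕ} {d : Fin N → ℕ} (h : ∀ j, Matrix (Fin (d j)) (Fin (d j)) ℂ)
    (a : ℕ) : Matrix (Partition d a) (Partition d a) ℂ :=
  (∑ j, onParticle j (h j)) ⊗ₖ (1 : Matrix (Fin a) (Fin a) ℂ)

/-- Partial trace over all partitions except the `k`-th:
`⟨x| Tr_{P(k)ᶜ} ρ |y⟩ = ∑_z ⟨x, z| ρ |y, z⟩`, the sum over the labels `z` of the other partitions.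
The label `f` below runs over the pairs `(x, z)`. -/
def reduceTo {M : ℕ} {P : Fin M → Type} [∀ k, Fintype (P k)] [∀ k, DecidableEq (P k)]
    (k : Fin M) (ρ : Matrix (∀ l, P l) (∀ l, P l) ℂ) : Matrix (P k) (P k) ℂ :=
  Matrix.of fun x y => ∑ f : (∀ l, P l), if f k = x then ρ f (Function.update f k y) else 0

/-- All values `∑ₖ F(Tr_{P(k)ᶜ} Φ(|ψ⟩⟨ψ|), H⁽ᵏ⁾)`, over all incoherent operations `Φ` whose output
consists of `M` partitions, each with any number of ancillary levels besides the `N` particles. -/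
def pureValues {M N : ℕ} {d : Fin M → Fin N → ℕ}
    (h : ∀ k j, Matrix (Fin (d k j)) (Fin (d k j)) ℂ)
    {ι : Type} [Fintype ι] [DecidableEq ι] (ψ : ι → ℂ) : Set ℝ :=
  {v | ∃ (a : Fin M → ℕ) (Φ : Matrix ι ι ℂ →ₗ[ℂ] Matrix (Output d a) (Output d a) ℂ),
    IsIncoherentOperation Φ ∧
      v = ∑ k, qfi (reduceTo k (Φ (pureState ψ))) (localHamiltonian (h k) (a k))}

/-- The distributed QFI coherence of a pure state. -/
def pureCoherence {M N : ℕ} {d : Fin M → Fin N → ℕ}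
    (h : ∀ k j, Matrix (Fin (d k j)) (Fin (d k j)) ℂ)
    {ι : Type} [Fintype ι] [DecidableEq ι] (ψ : ι → ℂ) : ℝ :=
  sSup (pureValues h ψ)

/-- All average values `∑ᵢ pᵢ C(|ψᵢ⟩)` over pure state decompositions `ρ = ∑ᵢ pᵢ |ψᵢ⟩⟨ψᵢ|`. -/
def roofValues {M N : ℕ} {d : Fin M → Fin N → ℕ}
    (h : ∀ k j, Matrix (Fin (d k j)) (Fin (d k j)) ℂ)
    {ι : Type} [Fintype ι] [DecidableEq ι] (ρ : Matrix ι ι ℂ) : Set ℝ :=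
  {v | ∃ (m : ℕ) (p : Fin m → ℝ) (ψ : Fin m → ι → ℂ),
    (∀ i, 0 ≤ p i) ∧ ∑ i, p i = 1 ∧ (∀ i, IsUnitVector (ψ i)) ∧
      ρ = ∑ i, p i • pureState (ψ i) ∧ v = ∑ i, p i * pureCoherence h (ψ i)}

/-- The distributed QFI coherence of a general state: the convex roof of `pureCoherence`. -/
def distributedQFICoherence {M N : ℕ} {d : Fin M → Fin N → ℕ}
    (h : ∀ k j, Matrix (Fin (d k j)) (Fin (d k j)) ℂ)
    (ι : Type) [Fintype ι] [DecidableEq ι] (ρ : Matrix ι ι ℂ) : ℝ :=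
  sInf (roofValues h ρ)

end CoherenceQFI

end

/-! The proof rests on one variational fact (`isGreatest_qfi`): the Fisher information is the
maximum over matrices `X` of a functional that is linear in the state. Lower bounds then come from a
trial `X`. Block-diagonal trials give superadditivity over orthogonal blocks (`sum_qfi_le`), and a
trial with a single entry bounds the Fisher information below by one coherence between levels of
different energy (`le_qfi_of_diagonal`).

Strong monotonicity on pure states follows from superadditivity. After an incoherent measurement, a
nearly optimal operation can be run on each branch, with the outcome written in the ancillas of
every partition. This is a single incoherent operation on the initial state, and the branches remain
orthogonal after the partial traces (`exists_mem_pureValues_ge`). The convex roof inherits the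
property by applying the Kraus operators to each vector of a decomposition, and its convexity
follows by joining decompositions.

The suprema are finite because the energies are bounded independently of the ancillas
(`qfi_diagonal_le`). Diagonal states commute with the Hamiltonians and have no Fisher information.
Conversely, since some `h k j` has two distinct diagonal entries, every off-diagonal entry of a
state forces positive coherence (`le_distributedQFICoherence_of_ne`).

Probabilities are absorbed into unnormalized vectors throughout, as the pure-state quantity is
homogeneous of degree two. -/

namespace CoherenceQFI

/-- The concave functional of `X` whose maximum is the quantum Fisher information. -/
noncomputable def fisherFunctional {ι : Type} [Fintype ι] (ρ H X : Matrix ι ι ℂ) : ℝ :=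
  2 * (Xᴴ * (ρ * H - H * ρ)).trace.re - 1 / 2 * (ρ * (X * Xᴴ + Xᴴ * X)).trace.re

/-! ### Quantum Fisher information: variational formula and bounds -/

section fisher

variable {ι κ : Type} [Fintype ι] [Fintype κ]

lemma fisherFunctional_sum {α : Type} (s : Finset α) (ρ : α → Matrix ι ι ℂ) (H X : Matrix ι ι ℂ) :
    fisherFunctional (∑ n ∈ s, ρ n) H X = ∑ n ∈ s, fisherFunctional (ρ n) H X := by
  simp only [fisherFunctional, Finset.sum_mul, Finset.mul_sum, ← Finset.sum_sub_distrib,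
    Matrix.trace_sum, Complex.re_sum]

lemma fisherFunctional_smul (c : ℝ) (ρ H X : Matrix ι ι ℂ) :
    fisherFunctional (c • ρ) H X = c * fisherFunctional ρ H X := by
  simp only [fisherFunctional, smul_mul_assoc, mul_smul_comm, ← smul_sub, Matrix.trace_smul,
    Complex.smul_re, smul_eq_mul]
  ring

/-- The range of the isometry `E` reduces both `H` and `X`, so they can be moved past `E`, and
cyclicity of the trace removes it. This serves for unitary changes of basis and for restriction to a
block. -/
lemma fisherFunctional_conj [DecidableEq κ] (E : Matrix ι κ ℂ) (hE : Eᴴ * E = 1)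
    {H X : Matrix ι ι ℂ} {G Y : Matrix κ κ ℂ} (hH : H * E = E * G) (hH' : Eᴴ * H = G * Eᴴ)
    (hX : X * E = E * Y) (hX' : Eᴴ * X = Y * Eᴴ) (τ : Matrix κ κ ℂ) :
    fisherFunctional (E * τ * Eᴴ) H X = fisherFunctional τ G Y := by
  have hX1 : Eᴴ * Xᴴ = Yᴴ * Eᴴ := by
    rw [← Matrix.conjTranspose_mul, hX, Matrix.conjTranspose_mul]
  have hX2 : Xᴴ * E = E * Yᴴ := by
    have := congrArg Matrix.conjTranspose hX'
    simpa [Matrix.conjTranspose_mul] using this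
  have h1 : Xᴴ * (E * τ * Eᴴ * H - H * (E * τ * Eᴴ)) = E * (Yᴴ * (τ * G - G * τ) * Eᴴ) := by
    have e1 : E * τ * Eᴴ * H = E * (τ * G) * Eᴴ := by
      rw [Matrix.mul_assoc _ Eᴴ H, hH']; simp only [Matrix.mul_assoc]
    have e2 : H * (E * τ * Eᴴ) = E * (G * τ) * Eᴴ := by
      rw [← Matrix.mul_assoc, ← Matrix.mul_assoc, hH]; simp only [Matrix.mul_assoc]
    rw [e1, e2, ← Matrix.sub_mul, ← Matrix.mul_sub, ← Matrix.mul_assoc, ← Matrix.mul_assoc, hX2]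
    simp only [Matrix.mul_assoc]
  have h2 : E * τ * Eᴴ * (X * Xᴴ + Xᴴ * X) = E * (τ * (Y * Yᴴ + Yᴴ * Y) * Eᴴ) := by
    have e1 : Eᴴ * (X * Xᴴ + Xᴴ * X) = (Y * Yᴴ + Yᴴ * Y) * Eᴴ := by
      rw [Matrix.mul_add, ← Matrix.mul_assoc, ← Matrix.mul_assoc, hX', hX1, Matrix.mul_assoc,
        Matrix.mul_assoc, hX', hX1, Matrix.add_mul, Matrix.mul_assoc, Matrix.mul_assoc]
    rw [Matrix.mul_assoc _ Eᴴ, e1]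
    simp only [Matrix.mul_assoc]
  rw [fisherFunctional, h1, h2, Matrix.trace_mul_comm E, Matrix.trace_mul_comm E,
    Matrix.mul_assoc _ Eᴴ E, Matrix.mul_assoc _ Eᴴ E, hE, Matrix.mul_one, Matrix.mul_one, fisherFunctional]

lemma fisherFunctional_diagonal [DecidableEq ι] (l : ι → ℝ) (G Y : Matrix ι ι ℂ) :
    fisherFunctional (Matrix.diagonal fun i => (l i : ℂ)) G Y =
      ∑ i, ∑ j, (2 * ((l i - l j) * (star (Y i j) * G i j).re) -
        1 / 2 * (l i + l j) * ‖Y i j‖ ^ 2) := by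
  have h1 : (Yᴴ * (Matrix.diagonal (fun i => (l i : ℂ)) * G -
      G * Matrix.diagonal fun i => (l i : ℂ))).trace.re =
      ∑ i, ∑ j, (l i - l j) * (star (Y i j) * G i j).re := by
    rw [Finset.sum_comm]
    simp only [Matrix.trace, Matrix.diag, Matrix.mul_apply (M := Yᴴ), Complex.re_sum,
      Matrix.sub_apply, Matrix.diagonal_mul, Matrix.mul_diagonal, Matrix.conjTranspose_apply]
    refine Finset.sum_congr rfl fun i _ => Finset.sum_congr rfl fun j _ => ?_
    rw [← Complex.re_ofReal_mul]
    congr 1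
    push_cast
    ring
  have h2 : (Matrix.diagonal (fun i => (l i : ℂ)) * (Y * Yᴴ + Yᴴ * Y)).trace.re =
      ∑ i, ∑ j, (l i + l j) * ‖Y i j‖ ^ 2 := by
    have key : ∀ z : ℂ, z * star z = ((‖z‖ ^ 2 : ℝ) : ℂ) := fun z => by
      rw [Complex.star_def, Complex.mul_conj, Complex.normSq_eq_norm_sq]
    have h3 : ∀ i, ((Matrix.diagonal (fun i => (l i : ℂ)) * (Y * Yᴴ + Yᴴ * Y)) i i).re =
        ∑ j, l i * ‖Y i j‖ ^ 2 + ∑ j, l i * ‖Y j i‖ ^ 2 := by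
      intro i
      rw [Matrix.diagonal_mul, Complex.re_ofReal_mul]
      simp only [Matrix.add_apply, Matrix.mul_apply, Matrix.conjTranspose_apply,
        mul_comm (star _), key, Complex.add_re, Complex.re_sum, Complex.ofReal_re, mul_add,
        Finset.mul_sum]
    simp only [add_mul, Finset.sum_add_distrib]
    rw [Finset.sum_comm (f := fun i j => l j * ‖Y i j‖ ^ 2)]
    simp only [Matrix.trace, Matrix.diag, Complex.re_sum, h3, Finset.sum_add_distrib]
  rw [fisherFunctional, h1, h2]
  simp only [Finset.mul_sum, ← Finset.sum_sub_distrib]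
  refine Finset.sum_congr rfl fun i _ => Finset.sum_congr rfl fun j _ => ?_
  ring

/-- Completing the square: the gap is `‖(l + m) y - 2 (l - m) g‖ ^ 2 / (2 (l + m))`. If `l + m = 0`,
both sides vanish. -/
lemma two_mul_re_sub_le {l m : ℝ} (hl : 0 ≤ l) (hm : 0 ≤ m) (y g : ℂ) :
    2 * ((l - m) * (star y * g).re) - 1 / 2 * (l + m) * ‖y‖ ^ 2 ≤
      2 * ((l - m) ^ 2 / (l + m) * ‖g‖ ^ 2) := by
  rcases (add_nonneg hl hm).eq_or_lt with h | h
  · obtain rfl : l = 0 := by linarith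
    obtain rfl : m = 0 := by linarith
    simp
  · have e : 2 * ((l - m) ^ 2 / (l + m) * ‖g‖ ^ 2) -
        (2 * ((l - m) * (star y * g).re) - 1 / 2 * (l + m) * ‖y‖ ^ 2) =
        1 / (2 * (l + m)) * ‖((l + m : ℝ) : ℂ) * y - ((2 * (l - m) : ℝ) : ℂ) * g‖ ^ 2 := by
      rw [← Complex.normSq_eq_norm_sq, ← Complex.normSq_eq_norm_sq, ← Complex.normSq_eq_norm_sq,
        Complex.normSq_apply, Complex.normSq_apply, Complex.normSq_apply]
      simp only [Complex.sub_re, Complex.sub_im, Complex.ofReal_re, Complex.ofReal_im,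
        Complex.mul_re, Complex.mul_im, Complex.star_def, Complex.conj_re, Complex.conj_im]
      field_simp
      ring
    have : 0 ≤ 1 / (2 * (l + m)) *
        ‖((l + m : ℝ) : ℂ) * y - ((2 * (l - m) : ℝ) : ℂ) * g‖ ^ 2 := by positivity
    linarith

/-- The completed square vanishes at this `y`. Up to a phase these are the entries of the symmetric
logarithmic derivative. -/
lemma two_mul_re_sub_eq {l m : ℝ} (hl : 0 ≤ l) (hm : 0 ≤ m) (g : ℂ) :
    2 * ((l - m) * (star (((2 * (l - m) / (l + m) : ℝ) : ℂ) * g) * g).re) -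
      1 / 2 * (l + m) * ‖((2 * (l - m) / (l + m) : ℝ) : ℂ) * g‖ ^ 2 =
      2 * ((l - m) ^ 2 / (l + m) * ‖g‖ ^ 2) := by
  rcases (add_nonneg hl hm).eq_or_lt with h | h
  · obtain rfl : l = 0 := by linarith
    obtain rfl : m = 0 := by linarith
    simp
  · rw [← Complex.normSq_eq_norm_sq, ← Complex.normSq_eq_norm_sq,
        Complex.normSq_apply, Complex.normSq_apply]
    simp only [Complex.ofReal_re, Complex.ofReal_im, Complex.mul_re, Complex.mul_im,
        Complex.star_def, Complex.conj_re, Complex.conj_im]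
    field_simp
    ring

variable [DecidableEq ι]

lemma inner_eigenvectorBasis_eq {ρ : Matrix ι ι ℂ} (hρ : ρ.IsHermitian) (H : Matrix ι ι ℂ)
    (i j : ι) :
    inner ℂ (hρ.eigenvectorBasis i) (Matrix.toEuclideanLin H (hρ.eigenvectorBasis j)) =
      ((hρ.eigenvectorUnitary : Matrix ι ι ℂ)ᴴ * H * hρ.eigenvectorUnitary) i j := by
  rw [Matrix.mul_assoc, Matrix.mul_apply, PiLp.inner_apply]
  refine Finset.sum_congr rfl fun x _ => ?_
  simp [Matrix.toEuclideanLin, Matrix.toLpLin_apply, Matrix.mul_apply, Matrix.mulVec, dotProduct,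
    Matrix.IsHermitian.eigenvectorUnitary_apply, mul_comm]

lemma fisherFunctional_eigenbasis {ρ : Matrix ι ι ℂ} (hρ : ρ.IsHermitian) (H Y : Matrix ι ι ℂ) :
    fisherFunctional ρ H
      ((hρ.eigenvectorUnitary : Matrix ι ι ℂ) * Y * (hρ.eigenvectorUnitary : Matrix ι ι ℂ)ᴴ) =
      fisherFunctional (Matrix.diagonal fun i => (hρ.eigenvalues i : ℂ))
        ((hρ.eigenvectorUnitary : Matrix ι ι ℂ)ᴴ * H * hρ.eigenvectorUnitary) Y := by
  set U := (hρ.eigenvectorUnitary : Matrix ι ι ℂ) with hU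
  have h1 : Uᴴ * U = 1 := Unitary.coe_star_mul_self hρ.eigenvectorUnitary
  have h2 : U * Uᴴ = 1 := Unitary.coe_mul_star_self hρ.eigenvectorUnitary
  have hs : ρ = U * Matrix.diagonal (fun i => (hρ.eigenvalues i : ℂ)) * Uᴴ := by
    conv_lhs => rw [hρ.spectral_theorem]
    rfl
  conv_lhs => rw [hs]
  apply fisherFunctional_conj U h1
  · rw [Matrix.mul_assoc Uᴴ, ← Matrix.mul_assoc U, h2, Matrix.one_mul]
  · rw [Matrix.mul_assoc _ U, h2, Matrix.mul_one]
  · rw [Matrix.mul_assoc, h1, Matrix.mul_one]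
  · rw [← Matrix.mul_assoc, ← Matrix.mul_assoc, h1, Matrix.one_mul]

lemma qfi_eq_sum {ρ : Matrix ι ι ℂ} (hρ : ρ.IsHermitian) (H : Matrix ι ι ℂ) :
    qfi ρ H = ∑ i, ∑ j, 2 * ((hρ.eigenvalues i - hρ.eigenvalues j) ^ 2 /
      (hρ.eigenvalues i + hρ.eigenvalues j) *
        ‖((hρ.eigenvectorUnitary : Matrix ι ι ℂ)ᴴ * H * hρ.eigenvectorUnitary) i j‖ ^ 2) := by
  rw [qfi, dif_pos hρ]
  simp only [inner_eigenvectorBasis_eq, Finset.mul_sum]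

/-- Variational characterization of the quantum Fisher information. -/
theorem isGreatest_qfi {ρ : Matrix ι ι ℂ} (hρ : ρ.PosSemidef) (H : Matrix ι ι ℂ) :
    IsGreatest (Set.range (fisherFunctional ρ H)) (qfi ρ H) := by
  have hh := hρ.isHermitian
  have hl := hρ.eigenvalues_nonneg
  constructor
  · refine ⟨_, (fisherFunctional_eigenbasis hh H (Matrix.of fun i j =>
      ((2 * (hh.eigenvalues i - hh.eigenvalues j) /
        (hh.eigenvalues i + hh.eigenvalues j) : ℝ) : ℂ) *
        ((hh.eigenvectorUnitary : Matrix ι ι ℂ)ᴴ * H * hh.eigenvectorUnitary) i j)).trans ?_⟩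
    rw [fisherFunctional_diagonal, qfi_eq_sum hh]
    exact Finset.sum_congr rfl fun i _ => Finset.sum_congr rfl fun j _ =>
      two_mul_re_sub_eq (hl i) (hl j) _
  · rintro _ ⟨X, rfl⟩
    set U := (hh.eigenvectorUnitary : Matrix ι ι ℂ) with hU
    have h2 : U * Uᴴ = 1 := Unitary.coe_mul_star_self hh.eigenvectorUnitary
    have hX : X = U * (Uᴴ * X * U) * Uᴴ := by
      rw [Matrix.mul_assoc, Matrix.mul_assoc _ U, h2, Matrix.mul_one, ← Matrix.mul_assoc, h2,
        Matrix.one_mul]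
    rw [hX, fisherFunctional_eigenbasis hh, fisherFunctional_diagonal, qfi_eq_sum hh]
    exact Finset.sum_le_sum fun i _ => Finset.sum_le_sum fun j _ =>
      two_mul_re_sub_le (hl i) (hl j) _ _

lemma qfi_nonneg {ρ : Matrix ι ι ℂ} (hρ : ρ.PosSemidef) (H : Matrix ι ι ℂ) : 0 ≤ qfi ρ H :=
  (isGreatest_qfi hρ H).2 ⟨0, by simp [fisherFunctional]⟩

lemma qfi_smul {c : ℝ} (hc : 0 ≤ c) {ρ : Matrix ι ι ℂ} (hρ : ρ.PosSemidef) (H : Matrix ι ι ℂ) :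
    qfi (c • ρ) H = c * qfi ρ H := by
  have hcρ : (c • ρ).PosSemidef := hρ.smul hc
  refine (isGreatest_qfi hcρ H).unique ⟨?_, ?_⟩
  · obtain ⟨X, hX⟩ := (isGreatest_qfi hρ H).1
    exact ⟨X, by rw [fisherFunctional_smul, hX]⟩
  · rintro _ ⟨X, rfl⟩
    rw [fisherFunctional_smul]
    exact mul_le_mul_of_nonneg_left ((isGreatest_qfi hρ H).2 ⟨X, rfl⟩) hc

/-- The quantum Fisher information is superadditive on orthogonal blocks. -/
lemma sum_qfi_le {α : Type} [Fintype α] [DecidableEq α] {β : α → Type} [∀ n, Fintype (β n)]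
    [∀ n, DecidableEq (β n)] (E : ∀ n, Matrix ι (β n) ℂ) (hE : ∀ n, (E n)ᴴ * E n = 1)
    (hE' : ∀ m n, m ≠ n → (E m)ᴴ * E n = 0) {H : Matrix ι ι ℂ} {G : ∀ n, Matrix (β n) (β n) ℂ}
    (hH : ∀ n, H * E n = E n * G n) (hH' : ∀ n, (E n)ᴴ * H = G n * (E n)ᴴ)
    {τ : ∀ n, Matrix (β n) (β n) ℂ} (hτ : ∀ n, (τ n).PosSemidef) :
    ∑ n, qfi (τ n) (G n) ≤ qfi (∑ n, E n * τ n * (E n)ᴴ) H := by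
  have hρ : (∑ n, E n * τ n * (E n)ᴴ).PosSemidef :=
    Matrix.posSemidef_sum _ fun n _ => (hτ n).mul_mul_conjTranspose_same (E n)
  choose X hX using fun n => (isGreatest_qfi (hτ n) (G n)).1
  -- The block-diagonal sum of the optimizers of the blocks is an admissible trial for the whole.
  refine le_trans (le_of_eq ?_) ((isGreatest_qfi hρ H).2 ⟨∑ m, E m * X m * (E m)ᴴ, rfl⟩)
  rw [fisherFunctional_sum]
  refine Finset.sum_congr rfl fun n _ => ?_
  rw [fisherFunctional_conj (E n) (hE n) (hH n) (hH' n) (Y := X n), hX]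
  · rw [Matrix.sum_mul, Finset.sum_eq_single n]
    · rw [Matrix.mul_assoc, hE, Matrix.mul_one]
    · intro m _ hm
      rw [Matrix.mul_assoc, hE' m n hm, Matrix.mul_zero]
    · simp
  · rw [Matrix.mul_sum, Finset.sum_eq_single n]
    · rw [Matrix.mul_assoc, ← Matrix.mul_assoc, hE, Matrix.one_mul]
    · intro m _ hm
      rw [Matrix.mul_assoc, ← Matrix.mul_assoc, hE' n m hm.symm, Matrix.zero_mul]
    · simp

/-- The commutator term of the functional vanishes and the quadratic term is nonpositive, so the
maximum is at most zero. -/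
lemma qfi_eq_zero_of_commute {ρ : Matrix ι ι ℂ} (hρ : ρ.PosSemidef) {H : Matrix ι ι ℂ}
    (hc : ρ * H = H * ρ) : qfi ρ H = 0 := by
  refine le_antisymm ?_ (qfi_nonneg hρ H)
  obtain ⟨X, hX⟩ := (isGreatest_qfi hρ H).1
  have e : (ρ * (X * Xᴴ + Xᴴ * X)).trace = (Xᴴ * ρ * X).trace + (X * ρ * Xᴴ).trace := by
    rw [Matrix.mul_add, Matrix.trace_add, ← Matrix.mul_assoc, ← Matrix.mul_assoc,
      Matrix.trace_mul_cycle, Matrix.trace_mul_cycle ρ]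
  have h1 := (Complex.le_def.1 (hρ.conjTranspose_mul_mul_same X).trace_nonneg).1
  have h2 := (Complex.le_def.1 (hρ.mul_mul_conjTranspose_same X).trace_nonneg).1
  rw [← hX, fisherFunctional, hc, sub_self, e, Complex.add_re]
  simp at h1 h2 ⊢
  linarith

lemma qfi_eq_zero_of_isDiag {ρ : Matrix ι ι ℂ} (hρ : ρ.PosSemidef) (hd : ρ.IsDiag)
    {H : Matrix ι ι ℂ} (hH : H.IsDiag) : qfi ρ H = 0 := by
  refine qfi_eq_zero_of_commute hρ ?_
  rw [← hd.diagonal_diag, ← hH.diagonal_diag, Matrix.diagonal_mul_diagonal,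
    Matrix.diagonal_mul_diagonal]
  simp only [mul_comm]

/-- Each coherence between levels of different energy bounds the Fisher information from below. -/
lemma le_qfi_of_diagonal {ρ : Matrix ι ι ℂ} (hρ : ρ.PosSemidef) (ht : ρ.trace = 1) (η : ι → ℂ)
    {x y : ι} (hxy : x ≠ y) :
    ‖ρ x y‖ ^ 2 * ‖η x - η y‖ ^ 2 ≤ qfi ρ (Matrix.diagonal η) := by
  -- The trial matrix has as its only entry that of the commutator at `(x, y)`. Its value is `(2 -
  -- (ρ x x + ρ y y) / 2) * ‖z‖ ^ 2`, at least `3 / 2 * ‖z‖ ^ 2` since the two populations sum to at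
  -- most one.
  set z : ℂ := ρ x y * (η y - η x) with hz
  refine le_trans ?_ ((isGreatest_qfi hρ _).2 ⟨Matrix.single x y z, rfl⟩)
  have hsum : (ρ x x).re + (ρ y y).re ≤ 1 := by
    have h1 : ∑ i, (ρ i i).re = 1 := by
      have := congrArg Complex.re ht
      simpa [Matrix.trace] using this
    rw [← h1, ← Finset.sum_pair (f := fun i => (ρ i i).re) hxy]
    exact Finset.sum_le_sum_of_subset_of_nonneg (Finset.subset_univ _)
      fun i _ _ => (Complex.le_def.1 (hρ.diag_nonneg (i := i))).1
  have e1 : ((Matrix.single x y z)ᴴ *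
      (ρ * Matrix.diagonal η - Matrix.diagonal η * ρ)).trace.re = ‖z‖ ^ 2 := by
    rw [Matrix.conjTranspose_single, Matrix.trace_single_mul, Matrix.sub_apply,
      Matrix.mul_diagonal, Matrix.diagonal_mul]
    have : ρ x y * η y - η x * ρ x y = z := by rw [hz]; ring
    rw [this, smul_eq_mul, Complex.star_def, mul_comm, Complex.mul_conj,
      Complex.normSq_eq_norm_sq, Complex.ofReal_re]
  have e2 : (ρ * (Matrix.single x y z * (Matrix.single x y z)ᴴ +
      (Matrix.single x y z)ᴴ * Matrix.single x y z)).trace.re =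
      ((ρ x x).re + (ρ y y).re) * ‖z‖ ^ 2 := by
    rw [Matrix.conjTranspose_single, Matrix.single_mul_single_same,
      Matrix.single_mul_single_same, Matrix.mul_add, Matrix.trace_add, Matrix.trace_mul_comm,
      Matrix.trace_mul_comm ρ, Matrix.trace_single_mul, Matrix.trace_single_mul,
      mul_comm (star z), Complex.star_def, Complex.mul_conj, Complex.normSq_eq_norm_sq,
      smul_eq_mul, smul_eq_mul, Complex.add_re, Complex.re_ofReal_mul, Complex.re_ofReal_mul]
    ring
  have e3 : ‖ρ x y‖ ^ 2 * ‖η x - η y‖ ^ 2 = ‖z‖ ^ 2 := by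
    rw [hz, norm_mul, mul_pow, norm_sub_rev]
  rw [fisherFunctional, e1, e2, e3]
  nlinarith [sq_nonneg ‖z‖]

/-- Each weight `(l - m) ^ 2 / (l + m)` is at most `l + m`. In the eigenbasis of `ρ` the rows and
columns of the Hamiltonian have squared norm at most `B ^ 2`; they are treated separately because
`η` may be complex. -/
lemma qfi_diagonal_le {ρ : Matrix ι ι ℂ} (hρ : ρ.PosSemidef) (η : ι → ℂ) {B : ℝ}
    (hB : ∀ x, ‖η x‖ ≤ B) : qfi ρ (Matrix.diagonal η) ≤ 4 * B ^ 2 * ρ.trace.re := by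
  have hh := hρ.isHermitian
  have hl := hρ.eigenvalues_nonneg
  set U := (hh.eigenvectorUnitary : Matrix ι ι ℂ) with hU
  have h1 : Uᴴ * U = 1 := Unitary.coe_star_mul_self hh.eigenvectorUnitary
  have h2 : U * Uᴴ = 1 := Unitary.coe_mul_star_self hh.eigenvectorUnitary
  set G := Uᴴ * Matrix.diagonal η * U with hG
  have key : ∀ z : ℂ, z * star z = ((‖z‖ ^ 2 : ℝ) : ℂ) := fun z => by
    rw [Complex.star_def, Complex.mul_conj, Complex.normSq_eq_norm_sq]
  have hcol : ∀ i, ∑ x, ‖U x i‖ ^ 2 = 1 := by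
    intro i
    have := congrFun (congrFun h1 i) i
    simp only [Matrix.mul_apply, Matrix.conjTranspose_apply, Matrix.one_apply_eq, mul_comm (star _),
      key] at this
    exact_mod_cast this
  have hbound : ∀ i, ∑ x, ‖η x‖ ^ 2 * ‖U x i‖ ^ 2 ≤ B ^ 2 := by
    intro i
    calc ∑ x, ‖η x‖ ^ 2 * ‖U x i‖ ^ 2 ≤ ∑ x, B ^ 2 * ‖U x i‖ ^ 2 := by
          gcongr with x; exact hB x
      _ = B ^ 2 := by rw [← Finset.mul_sum, hcol, mul_one]
  have hGG : G * Gᴴ = Uᴴ * Matrix.diagonal (fun x => ((‖η x‖ ^ 2 : ℝ) : ℂ)) * U := by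
    have : (Matrix.diagonal fun x => ((‖η x‖ ^ 2 : ℝ) : ℂ)) =
        Matrix.diagonal η * (Matrix.diagonal η)ᴴ := by
      rw [Matrix.diagonal_conjTranspose, Matrix.diagonal_mul_diagonal]
      simp only [Pi.star_apply, key]
    rw [this, hG]
    simp only [Matrix.conjTranspose_mul, Matrix.conjTranspose_conjTranspose, Matrix.mul_assoc]
    rw [← Matrix.mul_assoc U Uᴴ, h2, Matrix.one_mul]
  have hGG' : Gᴴ * G = Uᴴ * Matrix.diagonal (fun x => ((‖η x‖ ^ 2 : ℝ) : ℂ)) * U := by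
    have : (Matrix.diagonal fun x => ((‖η x‖ ^ 2 : ℝ) : ℂ)) =
        (Matrix.diagonal η)ᴴ * Matrix.diagonal η := by
      rw [Matrix.diagonal_conjTranspose, Matrix.diagonal_mul_diagonal]
      simp only [Pi.star_apply, mul_comm (star _), key]
    rw [this, hG]
    simp only [Matrix.conjTranspose_mul, Matrix.conjTranspose_conjTranspose, Matrix.mul_assoc]
    rw [← Matrix.mul_assoc U Uᴴ, h2, Matrix.one_mul]
  have hdiag : ∀ i, (Uᴴ * Matrix.diagonal (fun x => ((‖η x‖ ^ 2 : ℝ) : ℂ)) * U) i i =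
      ((∑ x, ‖η x‖ ^ 2 * ‖U x i‖ ^ 2 : ℝ) : ℂ) := by
    intro i
    rw [Matrix.mul_apply, Complex.ofReal_sum]
    refine Finset.sum_congr rfl fun x _ => ?_
    rw [Matrix.mul_diagonal, Matrix.conjTranspose_apply, Complex.ofReal_mul, ← key (U x i)]
    ring
  have hrow : ∀ i, ∑ j, ‖G i j‖ ^ 2 ≤ B ^ 2 := by
    intro i
    refine le_trans (le_of_eq ?_) (hbound i)
    have := (congrFun (congrFun hGG i) i).trans (hdiag i)
    simp only [Matrix.mul_apply, Matrix.conjTranspose_apply, key] at this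
    exact_mod_cast this
  have hcolG : ∀ j, ∑ i, ‖G i j‖ ^ 2 ≤ B ^ 2 := by
    intro j
    refine le_trans (le_of_eq ?_) (hbound j)
    have := (congrFun (congrFun hGG' j) j).trans (hdiag j)
    simp only [Matrix.mul_apply, Matrix.conjTranspose_apply, mul_comm (star _), key] at this
    exact_mod_cast this
  have htr : ρ.trace.re = ∑ i, hh.eigenvalues i := by
    rw [hh.trace_eq_sum_eigenvalues]; simp
  have hterm : ∀ l m g : ℝ, 0 ≤ l → 0 ≤ m → 0 ≤ g → (l - m) ^ 2 / (l + m) * g ≤ l * g + m * g := by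
    intro l m g hl hm hg
    rw [← add_mul]
    refine mul_le_mul_of_nonneg_right (div_le_of_le_mul₀ (by positivity) (by positivity) ?_) hg
    nlinarith [mul_nonneg hl hm]
  rw [qfi_eq_sum hh, htr]
  calc _ ≤ ∑ i, ∑ j, 2 * (hh.eigenvalues i * ‖G i j‖ ^ 2 + hh.eigenvalues j * ‖G i j‖ ^ 2) := by
        gcongr with i _ j _
        exact hterm _ _ _ (hl i) (hl j) (by positivity)
    _ = 2 * (∑ i, hh.eigenvalues i * ∑ j, ‖G i j‖ ^ 2 +
          ∑ j, hh.eigenvalues j * ∑ i, ‖G i j‖ ^ 2) := by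
        simp only [← Finset.mul_sum, Finset.sum_add_distrib]
        rw [Finset.sum_comm (f := fun i j => hh.eigenvalues j * ‖G i j‖ ^ 2)]
        simp only [← Finset.mul_sum]
    _ ≤ 2 * (∑ i, hh.eigenvalues i * B ^ 2 + ∑ j, hh.eigenvalues j * B ^ 2) := by
        gcongr with i _ j _
        · exact hl i
        · exact hrow i
        · exact hl j
        · exact hcolG j
    _ = _ := by rw [← Finset.sum_mul]; ring

end fisher

/-! ### Injections of basis labels as isometries -/

section embed

variable {α β γ : Type} [DecidableEq β]

/-- The matrix sending the basis vector `a` to the basis vector `e a`. -/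
def embed (e : α → β) : Matrix β α ℂ := Matrix.of fun b a => if b = e a then 1 else 0

lemma embed_conjTranspose_mul [Fintype β] (e : α → β) (f : γ → β) :
    (embed e)ᴴ * embed f = Matrix.of fun a c => if e a = f c then 1 else 0 := by
  ext a c
  rw [Matrix.mul_apply, Finset.sum_eq_single (e a)] <;> simp +contextual [embed]

lemma embed_isometry [Fintype β] [DecidableEq α] {e : α → β} (he : Function.Injective e) :
    (embed e)ᴴ * embed e = 1 := by
  ext a c
  simp [embed_conjTranspose_mul, he.eq_iff, Matrix.one_apply]

lemma embed_conjTranspose_mul_eq_zero [Fintype β] {e : α → β} {f : γ → β}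
    (h : ∀ a c, e a ≠ f c) : (embed e)ᴴ * embed f = 0 := by
  ext a c
  simp [embed_conjTranspose_mul, h]

lemma embed_comp [Fintype β] [DecidableEq γ] (e : β → γ) (f : α → β) :
    embed (e ∘ f) = embed e * embed f := by
  ext c a
  rw [Matrix.mul_apply, Finset.sum_eq_single (f a)] <;> simp +contextual [embed]

variable [Fintype α]

lemma embed_conj (e : α → β) (σ : Matrix α α ℂ) (b c : β) :
    (embed e * σ * (embed e)ᴴ) b c =
      ∑ a, ∑ a', if b = e a ∧ c = e a' then σ a a' else 0 := by
  simp only [Matrix.mul_apply, embed, Matrix.of_apply, Matrix.conjTranspose_apply, Finset.sum_mul]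
  rw [Finset.sum_comm]
  refine Finset.sum_congr rfl fun a _ => Finset.sum_congr rfl fun a' _ => ?_
  by_cases h1 : b = e a <;> by_cases h2 : c = e a' <;> simp [h1, h2]

lemma embed_conj_apply [DecidableEq α] {e : α → β} (he : Function.Injective e) (σ : Matrix α α ℂ)
    (a a' : α) : (embed e * σ * (embed e)ᴴ) (e a) (e a') = σ a a' := by
  simp [embed_conj, he.eq_iff, ite_and]

lemma embed_conj_of_not_mem_left {e : α → β} (σ : Matrix α α ℂ) {b : β} (hb : b ∉ Set.range e)
    (c : β) : (embed e * σ * (embed e)ᴴ) b c = 0 := by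
  rw [embed_conj]
  exact Finset.sum_eq_zero fun a _ => Finset.sum_eq_zero fun a' _ =>
    if_neg fun h => hb ⟨a, h.1.symm⟩

lemma embed_conj_of_not_mem_right {e : α → β} (σ : Matrix α α ℂ) (b : β) {c : β}
    (hc : c ∉ Set.range e) : (embed e * σ * (embed e)ᴴ) b c = 0 := by
  rw [embed_conj]
  exact Finset.sum_eq_zero fun a _ => Finset.sum_eq_zero fun a' _ =>
    if_neg fun h => hc ⟨a', h.2.symm⟩

lemma isDiag_embed_conj (e : α → β) {σ : Matrix α α ℂ} (hσ : σ.IsDiag) :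
    (embed e * σ * (embed e)ᴴ).IsDiag := by
  intro b c hbc
  rw [embed_conj]
  refine Finset.sum_eq_zero fun a _ => Finset.sum_eq_zero fun a' _ => ?_
  split_ifs with h
  · exact hσ fun haa => hbc (by rw [h.1, h.2, haa])
  · rfl

lemma diagonal_mul_embed [Fintype β] [DecidableEq α] (e : α → β) (η : β → ℂ) :
    Matrix.diagonal η * embed e = embed e * Matrix.diagonal (η ∘ e) := by
  ext b a
  rw [Matrix.diagonal_mul, Matrix.mul_diagonal]
  by_cases h : b = e a <;> simp [embed, h]

lemma embed_conjTranspose_mul_diagonal [Fintype β] [DecidableEq α] (e : α → β) (η : β → ℂ) :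
    (embed e)ᴴ * Matrix.diagonal η = Matrix.diagonal (η ∘ e) * (embed e)ᴴ := by
  ext a b
  rw [Matrix.diagonal_mul, Matrix.mul_diagonal]
  by_cases h : b = e a <;> simp [embed, h]

end embed

/-! ### Partial traces -/

section reduceTo

variable {M : ℕ} {P Q : Fin M → Type} [∀ k, Fintype (P k)] [∀ k, DecidableEq (P k)]
  [∀ k, Fintype (Q k)] [∀ k, DecidableEq (Q k)]

lemma reduceTo_sum {α : Type} (s : Finset α) (k : Fin M)
    (ρ : α → Matrix (∀ l, P l) (∀ l, P l) ℂ) :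
    reduceTo k (∑ n ∈ s, ρ n) = ∑ n ∈ s, reduceTo k (ρ n) := by
  ext x y
  simp only [reduceTo, Matrix.of_apply, Matrix.sum_apply]
  rw [Finset.sum_comm]
  refine Finset.sum_congr rfl fun f _ => ?_
  split_ifs <;> simp

lemma reduceTo_smul (k : Fin M) (c : ℝ) (ρ : Matrix (∀ l, P l) (∀ l, P l) ℂ) :
    reduceTo k (c • ρ) = c • reduceTo k ρ := by
  ext x y
  simp only [reduceTo, Matrix.of_apply, Matrix.smul_apply, Finset.smul_sum]
  refine Finset.sum_congr rfl fun f _ => ?_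
  split_ifs <;> simp

lemma trace_reduceTo (k : Fin M) (ρ : Matrix (∀ l, P l) (∀ l, P l) ℂ) :
    (reduceTo k ρ).trace = ρ.trace := by
  simp only [Matrix.trace, Matrix.diag, reduceTo, Matrix.of_apply]
  rw [Finset.sum_comm]
  simp

lemma isDiag_reduceTo (k : Fin M) {ρ : Matrix (∀ l, P l) (∀ l, P l) ℂ} (hρ : ρ.IsDiag) :
    (reduceTo k ρ).IsDiag := by
  intro x y hxy
  simp only [reduceTo, Matrix.of_apply]
  refine Finset.sum_eq_zero fun f _ => ?_
  split_ifs with h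
  · refine hρ fun hf => hxy ?_
    rw [← h, hf, Function.update_self]
  · rfl

/-- In this form positivity of the partial trace is immediate, each summand being a principal
submatrix. -/
lemma reduceTo_eq_sum_submatrix (k : Fin M) (ρ : Matrix (∀ l, P l) (∀ l, P l) ℂ) :
    reduceTo k ρ = ∑ z, ρ.submatrix (fun x => (Equiv.piSplitAt k P).symm (x, z))
      (fun x => (Equiv.piSplitAt k P).symm (x, z)) := by
  ext x y
  simp only [reduceTo, Matrix.of_apply, Matrix.sum_apply, Matrix.submatrix_apply]
  rw [← (Equiv.piSplitAt k P).symm.sum_comp, Fintype.sum_prod_type, Finset.sum_eq_single x]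
  · refine Finset.sum_congr rfl fun z _ => ?_
    rw [if_pos (by simp)]
    congr 1
    ext l
    by_cases h : l = k
    · subst h; simp
    · simp [h]
  · intro b _ hb
    refine Finset.sum_eq_zero fun z _ => if_neg ?_
    simpa using hb
  · simp

lemma posSemidef_reduceTo (k : Fin M) {ρ : Matrix (∀ l, P l) (∀ l, P l) ℂ} (hρ : ρ.PosSemidef) :
    (reduceTo k ρ).PosSemidef := by
  rw [reduceTo_eq_sum_submatrix]
  exact Matrix.posSemidef_sum _ fun z _ => hρ.submatrix _

/-- The partial trace commutes with local embeddings. -/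
lemma reduceTo_embed_pi (k : Fin M) {e : ∀ l, P l → Q l} (he : ∀ l, Function.Injective (e l))
    (σ : Matrix (∀ l, P l) (∀ l, P l) ℂ) :
    reduceTo k (embed (fun (f : ∀ l, P l) l => e l (f l)) * σ *
      (embed (fun (f : ∀ l, P l) l => e l (f l)))ᴴ) =
      embed (e k) * reduceTo k σ * (embed (e k))ᴴ := by
  set E : (∀ l, P l) → ∀ l, Q l := fun f l => e l (f l) with hE
  have hEi : Function.Injective E := fun f g h => funext fun l => he l (congrFun h l)
  ext x y
  by_cases hx : x ∈ Set.range (e k)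
  swap
  · rw [embed_conj_of_not_mem_left _ hx]
    simp only [reduceTo, Matrix.of_apply]
    refine Finset.sum_eq_zero fun f _ => ?_
    split_ifs with h
    · refine embed_conj_of_not_mem_left _ ?_ _
      rintro ⟨g, rfl⟩
      exact hx ⟨g k, h⟩
    · rfl
  by_cases hy : y ∈ Set.range (e k)
  swap
  · rw [embed_conj_of_not_mem_right _ _ hy]
    simp only [reduceTo, Matrix.of_apply]
    refine Finset.sum_eq_zero fun f _ => ?_
    split_ifs with h
    · refine embed_conj_of_not_mem_right _ _ ?_
      rintro ⟨g, hg⟩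
      exact hy ⟨g k, by simpa [hE] using congrFun hg k⟩
    · rfl
  obtain ⟨x, rfl⟩ := hx
  obtain ⟨y, rfl⟩ := hy
  rw [embed_conj_apply (he k)]
  simp only [reduceTo, Matrix.of_apply]
  symm
  refine Fintype.sum_of_injective E hEi _ _ ?_ ?_
  · intro f hf
    rw [embed_conj_of_not_mem_left _ hf, ite_self]
  · intro f
    have hu : Function.update (E f) k (e k y) = E (Function.update f k y) := by
      ext l
      by_cases h : l = k
      · subst h; simp [hE]
      · simp [hE, h]
    rw [hu, embed_conj_apply hEi]
    simp [hE, (he k).eq_iff]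

/-- The embedding adjoins the fixed basis state `b` on the other partitions; tracing them out undoes
it. -/
lemma reduceTo_embed_update (k : Fin M) (b : ∀ l, P l) (τ : Matrix (P k) (P k) ℂ) :
    reduceTo k (embed (Function.update b k) * τ * (embed (Function.update b k))ᴴ) = τ := by
  have hi := Function.update_injective b k
  ext x y
  simp only [reduceTo, Matrix.of_apply]
  rw [Finset.sum_eq_single (Function.update b k x)]
  · rw [if_pos (by simp), Function.update_idem, embed_conj_apply hi]
  · intro f _ hf
    split_ifs with h
    · refine embed_conj_of_not_mem_left _ ?_ _
      rintro ⟨z, rfl⟩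
      exact hf (by rw [← h]; simp)
    · rfl
  · simp

end reduceTo

/-! ### Pure states and incoherent operations -/

section operations

variable {ι κ : Type}

lemma pureState_smul (z : ℂ) (ψ : ι → ℂ) : pureState (z • ψ) = (‖z‖ ^ 2 : ℝ) • pureState ψ := by
  ext i j
  simp only [pureState, Matrix.vecMulVec_apply, Pi.smul_apply, Pi.star_apply, Matrix.smul_apply,
    smul_eq_mul, star_mul', Complex.real_smul]
  rw [← Complex.normSq_eq_norm_sq, ← Complex.mul_conj, Complex.star_def]
  ring

lemma pureState_sqrt_smul {p : ℝ} (hp : 0 ≤ p) (ψ : ι → ℂ) :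
    pureState ((√p : ℂ) • ψ) = p • pureState ψ := by
  rw [pureState_smul, Complex.norm_real, Real.norm_eq_abs, sq_abs, Real.sq_sqrt hp]

variable [Fintype ι]

lemma posSemidef_pureState (ψ : ι → ℂ) : (pureState ψ).PosSemidef :=
  Matrix.posSemidef_vecMulVec_self_star ψ

lemma pureState_mulVec (K : Matrix κ ι ℂ) (ψ : ι → ℂ) :
    pureState (K *ᵥ ψ) = K * pureState ψ * Kᴴ := by
  rw [pureState, pureState, Matrix.mul_vecMulVec, Matrix.vecMulVec_mul, Matrix.star_mulVec]

lemma sum_pureState_conj {m : ℕ} (K : Matrix κ ι ℂ) (v : Fin m → ι → ℂ) :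
    K * (∑ i, pureState (v i)) * Kᴴ = ∑ i, pureState (K *ᵥ v i) := by
  simp only [Matrix.mul_sum, Matrix.sum_mul, pureState_mulVec]

lemma trace_pureState (ψ : ι → ℂ) : (pureState ψ).trace = ((∑ i, ‖ψ i‖ ^ 2 : ℝ) : ℂ) := by
  simp only [Matrix.trace, Matrix.diag, pureState, Matrix.vecMulVec_apply, Pi.star_apply,
    Complex.star_def, Complex.mul_conj, Complex.normSq_eq_norm_sq, Complex.ofReal_sum]

variable [DecidableEq ι]

open scoped MatrixOrder Matrix.Norms.L2Operator in
lemma exists_eq_sum_pureState {ρ : Matrix ι ι ℂ} (hρ : ρ.PosSemidef) :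
    ∃ v : ι → ι → ℂ, ρ = ∑ i, pureState (v i) := by
  obtain ⟨B, rfl⟩ := CStarAlgebra.nonneg_iff_eq_star_mul_self.mp hρ.nonneg
  refine ⟨fun i => star (B i), ?_⟩
  ext x y
  simp [Matrix.mul_apply, Matrix.sum_apply, pureState, Matrix.vecMulVec_apply,
    Matrix.star_eq_conjTranspose]

/-- Incoherence of `K` is only tested on states, but the basis projectors are states and span the
diagonal matrices. -/
lemma isDiag_conj_of_incoherent {K : Matrix κ ι ℂ}
    (hK : ∀ σ : Matrix ι ι ℂ, IsIncoherentState σ → (K * σ * Kᴴ).IsDiag) {σ : Matrix ι ι ℂ}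
    (hσ : σ.IsDiag) : (K * σ * Kᴴ).IsDiag := by
  have hs : ∀ j : ι, (K * Matrix.single j j (1 : ℂ) * Kᴴ).IsDiag := by
    intro j
    refine hK _ ⟨⟨?_, by simp⟩, ?_⟩
    · rw [← Matrix.diagonal_single]
      exact Matrix.PosSemidef.diagonal fun i => by
        by_cases h : i = j
        · subst h; simp
        · simp [h]
    · rw [← Matrix.diagonal_single]
      exact Matrix.isDiag_diagonal _
  have e : K * σ * Kᴴ = ∑ j, σ j j • (K * Matrix.single j j (1 : ℂ) * Kᴴ) := by
    conv_lhs => rw [← hσ.diagonal_diag, ← Matrix.sum_single_eq_diagonal]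
    simp only [Matrix.mul_sum, Matrix.sum_mul]
    refine Finset.sum_congr rfl fun j _ => ?_
    rw [← Matrix.smul_mul, ← Matrix.mul_smul, Matrix.smul_single, smul_eq_mul, mul_one,
      Matrix.diag_apply]
  rw [e]
  intro a b hab
  rw [Matrix.sum_apply]
  exact Finset.sum_eq_zero fun j _ => by rw [Matrix.smul_apply, hs j hab, smul_zero]

variable [Fintype κ]

/-- The map with Kraus operators `K n`. -/
def krausMap {α : Type} [Fintype α] (K : α → Matrix κ ι ℂ) : Matrix ι ι ℂ →ₗ[ℂ] Matrix κ κ ℂ where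
  toFun ρ := ∑ n, K n * ρ * (K n)ᴴ
  map_add' := by simp [Matrix.mul_add, Matrix.add_mul, Finset.sum_add_distrib]
  map_smul' := by simp [Finset.smul_sum]

lemma isIncoherentOperation_krausMap {α : Type} [Fintype α] (K : α → Matrix κ ι ℂ)
    (h1 : ∑ n, (K n)ᴴ * K n = 1)
    (h2 : ∀ n, ∀ σ : Matrix ι ι ℂ, σ.IsDiag → (K n * σ * (K n)ᴴ).IsDiag) :
    IsIncoherentOperation (krausMap K) := by
  let e := (Fintype.equivFin α).symm
  refine ⟨Fintype.card α, K ∘ e, ⟨?_, fun n σ hσ => h2 _ σ hσ.2⟩, fun ρ => ?_⟩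
  · rw [← h1]
    exact e.sum_comp fun n => (K n)ᴴ * K n
  · exact (e.sum_comp fun n => K n * ρ * (K n)ᴴ).symm

lemma isIncoherentOperation_embed [DecidableEq κ] {e : ι → κ} (he : Function.Injective e) :
    IsIncoherentOperation (krausMap fun _ : Unit => embed e) :=
  isIncoherentOperation_krausMap _ (by simp [embed_isometry he])
    fun _ _ hσ => isDiag_embed_conj e hσ

lemma IsIncoherentOperation.isDiag {Φ : Matrix ι ι ℂ →ₗ[ℂ] Matrix κ κ ℂ}
    (hΦ : IsIncoherentOperation Φ) {σ : Matrix ι ι ℂ} (hσ : σ.IsDiag) : (Φ σ).IsDiag := by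
  obtain ⟨r, K, hK, h⟩ := hΦ
  rw [h]
  intro a b hab
  rw [Matrix.sum_apply]
  exact Finset.sum_eq_zero fun n _ => isDiag_conj_of_incoherent (hK.2 n) hσ hab

lemma IsIncoherentOperation.posSemidef {Φ : Matrix ι ι ℂ →ₗ[ℂ] Matrix κ κ ℂ}
    (hΦ : IsIncoherentOperation Φ) {σ : Matrix ι ι ℂ} (hσ : σ.PosSemidef) : (Φ σ).PosSemidef := by
  obtain ⟨r, K, -, h⟩ := hΦ
  rw [h]
  exact Matrix.posSemidef_sum _ fun n _ => hσ.mul_mul_conjTranspose_same _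

lemma IsIncoherentOperation.trace_eq {Φ : Matrix ι ι ℂ →ₗ[ℂ] Matrix κ κ ℂ}
    (hΦ : IsIncoherentOperation Φ) (σ : Matrix ι ι ℂ) : (Φ σ).trace = σ.trace := by
  obtain ⟨r, K, hK, h⟩ := hΦ
  rw [h, Matrix.trace_sum]
  simp only [Matrix.trace_mul_cycle (K _)]
  rw [← Matrix.trace_sum, ← Matrix.sum_mul, hK.1, Matrix.one_mul]

end operations

/-! ### Local Hamiltonians and energies -/

section hamiltonian

variable {N : ℕ} {d : Fin N → ℕ} {h : ∀ j, Matrix (Fin (d j)) (Fin (d j)) ℂ}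

/-- Energy of a product basis state. -/
def energy (h : ∀ j, Matrix (Fin (d j)) (Fin (d j)) ℂ) (x : Particles d) : ℂ :=
  ∑ j, h j (x j) (x j)

lemma localHamiltonian_eq_diagonal (hd : ∀ j, (h j).IsDiag) (a : ℕ) :
    localHamiltonian h a = Matrix.diagonal fun x : Partition d a => energy h x.1 := by
  have h1 : ∑ j, onParticle j (h j) = Matrix.diagonal (energy h) := by
    ext x y
    simp only [Matrix.sum_apply, onParticle, Matrix.of_apply]
    by_cases hxy : x = y
    · subst hxy
      simp [energy]
    · rw [Matrix.diagonal_apply_ne _ hxy]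
      refine Finset.sum_eq_zero fun j _ => ?_
      split_ifs with hl
      · refine hd j fun hj => hxy (funext fun l => ?_)
        by_cases e : l = j
        · subst e; exact hj
        · exact hl l e
      · rfl
  rw [localHamiltonian, h1, ← Matrix.diagonal_one, Matrix.diagonal_kronecker_diagonal]
  simp

lemma norm_energy_le (x : Particles d) : ‖energy h x‖ ≤ ∑ j, ∑ y, ‖h j y y‖ :=
  (norm_sum_le _ _).trans <| Finset.sum_le_sum fun j _ =>
    Finset.single_le_sum (f := fun y => ‖h j y y‖) (fun _ _ => norm_nonneg _)
      (Finset.mem_univ (x j))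

lemma energy_update_sub (x : Particles d) (j : Fin N) (y : Fin (d j)) :
    energy h (Function.update x j y) - energy h x = h j y y - h j (x j) (x j) := by
  rw [energy, energy, ← Finset.sum_sub_distrib, Finset.sum_eq_single j]
  · rw [Function.update_self]
  · intro l _ hl
    rw [Function.update_of_ne hl, sub_self]
  · simp

end hamiltonian

/-! ### Coherence of pure states -/

open scoped Pointwise in
lemma pureValues_smul {M N : ℕ} {d : Fin M → Fin N → ℕ}
    (h : ∀ k j, Matrix (Fin (d k j)) (Fin (d k j)) ℂ) {ι : Type} [Fintype ι] [DecidableEq ι]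
    (z : ℂ) (ψ : ι → ℂ) : pureValues h (z • ψ) = (‖z‖ ^ 2 : ℝ) • pureValues h ψ := by
  have key : ∀ (a : Fin M → ℕ) (Φ : Matrix ι ι ℂ →ₗ[ℂ] Matrix (Output d a) (Output d a) ℂ),
      IsIncoherentOperation Φ →
      ∑ k, qfi (reduceTo k (Φ (pureState (z • ψ)))) (localHamiltonian (h k) (a k)) =
        ‖z‖ ^ 2 * ∑ k, qfi (reduceTo k (Φ (pureState ψ))) (localHamiltonian (h k) (a k)) := by
    intro a Φ hΦ
    rw [pureState_smul, LinearMap.map_smul_of_tower, Finset.mul_sum]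
    refine Finset.sum_congr rfl fun k _ => ?_
    rw [reduceTo_smul, qfi_smul (by positivity)
      (posSemidef_reduceTo k (hΦ.posSemidef (posSemidef_pureState ψ)))]
  ext v
  rw [Set.mem_smul_set]
  constructor
  · rintro ⟨a, Φ, hΦ, rfl⟩
    exact ⟨_, ⟨a, Φ, hΦ, rfl⟩, (key a Φ hΦ).symm⟩
  · rintro ⟨_, ⟨a, Φ, hΦ, rfl⟩, rfl⟩
    exact ⟨a, Φ, hΦ, (key a Φ hΦ).symm⟩

section coherence

variable {M N : ℕ} {d : Fin M → Fin N → ℕ} {h : ∀ k j, Matrix (Fin (d k j)) (Fin (d k j)) ℂ}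
  {ι κ : Type} [Fintype ι] [DecidableEq ι] [Fintype κ] [DecidableEq κ]

lemma pureCoherence_smul (z : ℂ) (ψ : ι → ℂ) :
    pureCoherence h (z • ψ) = ‖z‖ ^ 2 * pureCoherence h ψ := by
  rw [pureCoherence, pureValues_smul, Real.sSup_smul_of_nonneg (by positivity), smul_eq_mul,
    pureCoherence]

lemma pureCoherence_sqrt_smul {p : ℝ} (hp : 0 ≤ p) (ψ : ι → ℂ) :
    pureCoherence h ((√p : ℂ) • ψ) = p * pureCoherence h ψ := by
  rw [pureCoherence_smul, Complex.norm_real, Real.norm_eq_abs, sq_abs, Real.sq_sqrt hp]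

lemma nonneg_of_mem_pureValues {ψ : ι → ℂ} {v : ℝ} (hv : v ∈ pureValues h ψ) : 0 ≤ v := by
  obtain ⟨a, Φ, hΦ, rfl⟩ := hv
  exact Finset.sum_nonneg fun k _ => qfi_nonneg
    (posSemidef_reduceTo k (hΦ.posSemidef (posSemidef_pureState ψ))) _

lemma pureCoherence_nonneg (ψ : ι → ℂ) : 0 ≤ pureCoherence h ψ :=
  Real.sSup_nonneg fun _ => nonneg_of_mem_pureValues

/-- Copying the input label into every ancilla is incoherent. The map of labels is injective because
there is at least one partition, `k₀`. -/
lemma nonempty_pureValues (k₀ : Fin M) (b : ∀ k, Particles (d k)) (ψ : ι → ℂ) :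
    (pureValues h ψ).Nonempty :=
  ⟨_, fun _ => Fintype.card ι, _, isIncoherentOperation_embed
    (e := fun (m : ι) k => ((b k, Fintype.equivFin ι m) : Partition (d k) (Fintype.card ι)))
    (fun m m' hm => by simpa using congrArg Prod.snd (congrFun hm k₀)), rfl⟩

/-- The energy of a label ignores its ancilla part and the trace is preserved, so the bound is
uniform in the ancilla dimensions. -/
lemma bddAbove_pureValues (hd : ∀ k j, (h k j).IsDiag) (ψ : ι → ℂ) :
    BddAbove (pureValues h ψ) := by
  refine ⟨∑ k, 4 * (∑ j, ∑ y, ‖h k j y y‖) ^ 2 * ∑ i, ‖ψ i‖ ^ 2, ?_⟩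
  rintro _ ⟨a, Φ, hΦ, rfl⟩
  refine Finset.sum_le_sum fun k _ => ?_
  rw [localHamiltonian_eq_diagonal (hd k)]
  refine (qfi_diagonal_le (posSemidef_reduceTo k (hΦ.posSemidef (posSemidef_pureState ψ))) _
    fun x => norm_energy_le x.1).trans_eq ?_
  rw [trace_reduceTo, hΦ.trace_eq, trace_pureState, Complex.ofReal_re]

lemma isLUB_pureCoherence (hd : ∀ k j, (h k j).IsDiag) (k₀ : Fin M) (b : ∀ k, Particles (d k))
    (ψ : ι → ℂ) : IsLUB (pureValues h ψ) (pureCoherence h ψ) :=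
  isLUB_csSup (nonempty_pureValues k₀ b ψ) (bddAbove_pureValues hd ψ)

lemma isDiag_localHamiltonian (hd : ∀ k j, (h k j).IsDiag) (k : Fin M) (a : ℕ) :
    (localHamiltonian (h k) a).IsDiag := by
  rw [localHamiltonian_eq_diagonal (hd k)]
  exact Matrix.isDiag_diagonal _

lemma pureCoherence_eq_zero (hd : ∀ k j, (h k j).IsDiag) {ψ : ι → ℂ} (hψ : (pureState ψ).IsDiag) :
    pureCoherence h ψ = 0 := by
  refine le_antisymm (Real.sSup_nonpos ?_) (pureCoherence_nonneg ψ)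
  rintro _ ⟨a, Φ, hΦ, rfl⟩
  exact le_of_eq <| Finset.sum_eq_zero fun k _ => qfi_eq_zero_of_isDiag
    (posSemidef_reduceTo k (hΦ.posSemidef (posSemidef_pureState ψ)))
    (isDiag_reduceTo k (hΦ.isDiag hψ)) (isDiag_localHamiltonian hd k _)

/-- Running an incoherent operation on each branch of an incoherent measurement, with the outcome
recorded in the ancillas of every partition. -/
lemma exists_mem_pureValues_ge (hd : ∀ k j, (h k j).IsDiag) {r : ℕ} {K : Fin r → Matrix κ ι ℂ}
    (hK : IsIncoherentKraus K) (ψ : ι → ℂ) {w : Fin r → ℝ}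
    (hw : ∀ n, w n ∈ pureValues h (K n *ᵥ ψ)) : ∃ v ∈ pureValues h ψ, ∑ n, w n ≤ v := by
  choose a Φ hΦ hwv using hw
  choose s L hL hLΦ using hΦ
  -- The new ancilla of each partition is the direct sum of the branch ancillas, so its level also
  -- identifies the outcome `n`.
  let A : Fin M → ℕ := fun k => ∑ n, a n k
  let e : ∀ n k, Partition (d k) (a n k) → Partition (d k) (A k) :=
    fun n k x => (x.1, finSigmaFinEquiv ⟨n, x.2⟩)
  have he : ∀ n k, Function.Injective (e n k) := by
    rintro n k ⟨x, i⟩ ⟨y, j⟩ hxy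
    simpa [e] using hxy
  have he' : ∀ m n, m ≠ n → ∀ k x y, e m k x ≠ e n k y := by
    intro m n hmn k x y hxy
    have := finSigmaFinEquiv.injective (congrArg Prod.snd hxy)
    exact hmn (congrArg Sigma.fst this)
  let E : ∀ n, Output d (a n) → Output d A := fun n f k => e n k (f k)
  have hE : ∀ n, Function.Injective (E n) :=
    fun n f g hfg => funext fun k => he n k (congrFun hfg k)
  let T : (Σ n, Fin (s n)) → Matrix (Output d A) ι ℂ := fun q => embed (E q.1) * L q.1 q.2 * K q.1
  have hT : IsIncoherentOperation (krausMap T) := by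
    refine isIncoherentOperation_krausMap T ?_ ?_
    · rw [Fintype.sum_sigma, ← hK.1]
      refine Finset.sum_congr rfl fun n _ => ?_
      have : ∀ l, (T ⟨n, l⟩)ᴴ * T ⟨n, l⟩ = (K n)ᴴ * ((L n l)ᴴ * L n l) * K n := by
        intro l
        simp only [T, Matrix.conjTranspose_mul, Matrix.mul_assoc]
        rw [← Matrix.mul_assoc (embed (E n))ᴴ, embed_isometry (hE n), Matrix.one_mul]
      simp only [this]
      rw [← Matrix.sum_mul, ← Matrix.mul_sum, (hL n).1, Matrix.mul_one]
    · rintro ⟨n, l⟩ σ hσ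
      have := isDiag_embed_conj (E n) (isDiag_conj_of_incoherent ((hL n).2 l)
        (isDiag_conj_of_incoherent (hK.2 n) hσ))
      simpa only [T, Matrix.conjTranspose_mul, Matrix.mul_assoc] using this
  have hTψ : krausMap T (pureState ψ) =
      ∑ n, embed (E n) * Φ n (pureState (K n *ᵥ ψ)) * (embed (E n))ᴴ := by
    change ∑ q, T q * pureState ψ * (T q)ᴴ = _
    rw [Fintype.sum_sigma]
    refine Finset.sum_congr rfl fun n _ => ?_
    rw [hLΦ, pureState_mulVec, Matrix.mul_sum, Matrix.sum_mul]
    refine Finset.sum_congr rfl fun l _ => ?_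
    simp only [T, Matrix.conjTranspose_mul, Matrix.mul_assoc]
  have hΦ : ∀ n, IsIncoherentOperation (Φ n) := fun n => ⟨s n, L n, hL n, hLΦ n⟩
  refine ⟨_, ⟨A, krausMap T, hT, rfl⟩, ?_⟩
  simp only [hwv]
  rw [Finset.sum_comm, hTψ]
  refine Finset.sum_le_sum fun k _ => ?_
  -- Each reduced state is a sum over orthogonal ancilla blocks that the Hamiltonian respects, so
  -- superadditivity applies.
  rw [reduceTo_sum]
  have hr : ∀ n, reduceTo k (embed (E n) * Φ n (pureState (K n *ᵥ ψ)) * (embed (E n))ᴴ) =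
      embed (e n k) * reduceTo k (Φ n (pureState (K n *ᵥ ψ))) * (embed (e n k))ᴴ :=
    fun n => reduceTo_embed_pi k (he n) _
  simp only [hr]
  refine sum_qfi_le (fun n => embed (e n k)) (fun n => embed_isometry (he n k))
    (fun m n hmn => embed_conjTranspose_mul_eq_zero (he' m n hmn k)) (fun n => ?_) (fun n => ?_)
    (fun n => posSemidef_reduceTo k ((hΦ n).posSemidef (posSemidef_pureState _)))
  · rw [localHamiltonian_eq_diagonal (hd k), localHamiltonian_eq_diagonal (hd k)]
    exact diagonal_mul_embed (e n k) _
  · rw [localHamiltonian_eq_diagonal (hd k), localHamiltonian_eq_diagonal (hd k)]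
    exact embed_conjTranspose_mul_diagonal (e n k) _

/-- Strong monotonicity on (unnormalized) pure states. -/
lemma sum_pureCoherence_le (hd : ∀ k j, (h k j).IsDiag) (k₀ : Fin M) (b : ∀ k, Particles (d k))
    {r : ℕ} {K : Fin r → Matrix κ ι ℂ} (hK : IsIncoherentKraus K) (ψ : ι → ℂ) :
    ∑ n, pureCoherence h (K n *ᵥ ψ) ≤ pureCoherence h ψ := by
  refine le_of_forall_pos_le_add fun ε hε => ?_
  -- The error is shared among the `r` outcomes; dividing by `r + 1` also covers `r = 0`.
  have hδ : 0 < ε / (r + 1) := by positivity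
  choose w hw hwlt using fun n => exists_lt_of_lt_csSup
    (nonempty_pureValues (h := h) k₀ b (K n *ᵥ ψ)) (sub_lt_self (pureCoherence h (K n *ᵥ ψ)) hδ)
  obtain ⟨v, hv, hle⟩ := exists_mem_pureValues_ge hd hK ψ hw
  have h1 : v ≤ pureCoherence h ψ := le_csSup (bddAbove_pureValues hd ψ) hv
  have h2 : ∑ n, pureCoherence h (K n *ᵥ ψ) ≤ ∑ n, (w n + ε / (r + 1)) :=
    Finset.sum_le_sum fun n _ => by linarith [hwlt n]
  have h3 : (r : ℝ) * (ε / (r + 1)) ≤ ε := by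
    rw [mul_div_assoc', div_le_iff₀ (by positivity)]
    nlinarith
  rw [Finset.sum_add_distrib, Finset.sum_const, Finset.card_univ, Fintype.card_fin,
    nsmul_eq_mul] at h2
  linarith

/-- Coherence between any two levels can be mapped incoherently to coherence between two
configurations of particles. -/
lemma le_pureCoherence (hd : ∀ k j, (h k j).IsDiag) (k₀ : Fin M) (b : ∀ k, Particles (d k))
    (x y : Particles (d k₀)) {ψ : ι → ℂ} (hψ : IsUnitVector ψ) {i j : ι} (hij : i ≠ j) :
    ‖pureState ψ i j‖ ^ 2 * ‖energy (h k₀) x - energy (h k₀) y‖ ^ 2 ≤ pureCoherence h ψ := by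
  let P : Fin M → Type := fun k => Partition (d k) (Fintype.card ι)
  -- The particles only distinguish `i` from the other labels; the ancilla copy of the label keeps
  -- `w` injective.
  let w : ι → P k₀ := fun m => (if m = i then x else y, Fintype.equivFin ι m)
  let b' : ∀ k, P k := fun k => (b k, Fintype.equivFin ι i)
  have hw : Function.Injective w := fun m m' hm => by simpa [w] using congrArg Prod.snd hm
  have hb : Function.Injective (Function.update b' k₀) := Function.update_injective b' k₀
  have hΦ := isIncoherentOperation_embed (hb.comp hw)
  refine le_trans ?_ (le_csSup (bddAbove_pureValues hd ψ) ⟨fun _ => Fintype.card ι, _, hΦ, rfl⟩)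
  have hps := fun k => posSemidef_reduceTo k (hΦ.posSemidef (posSemidef_pureState ψ))
  refine le_trans ?_ (Finset.single_le_sum (f := fun k => qfi (reduceTo k
    (krausMap (fun _ : Unit => embed (Function.update b' k₀ ∘ w)) (pureState ψ)))
      (localHamiltonian (h k) (Fintype.card ι)))
    (fun k _ => qfi_nonneg (hps k) _) (Finset.mem_univ k₀))
  have hρ : reduceTo k₀
      (krausMap (fun _ : Unit => embed (Function.update b' k₀ ∘ w)) (pureState ψ)) =
      embed w * pureState ψ * (embed w)ᴴ := by
    rw [← reduceTo_embed_update k₀ b' (embed w * pureState ψ * (embed w)ᴴ)]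
    congr 1
    change ∑ _ : Unit, _ = _
    rw [Fintype.sum_unique, embed_comp]
    simp only [Matrix.conjTranspose_mul, Matrix.mul_assoc]
  have hij' : w i ≠ w j := hw.ne hij
  have ht : (embed w * pureState ψ * (embed w)ᴴ).trace = 1 := by
    rw [← hρ, trace_reduceTo, hΦ.trace_eq, trace_pureState, hψ, Complex.ofReal_one]
  have := le_qfi_of_diagonal ((posSemidef_pureState ψ).mul_mul_conjTranspose_same (embed w)) ht
    (fun z : P k₀ => energy (h k₀) z.1) hij'
  rw [embed_conj_apply hw] at this
  simp only [hρ, localHamiltonian_eq_diagonal (hd k₀)]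
  simpa [w, hij.symm] using this

end coherence

/-! ### The convex roof -/

section roof

variable {M N : ℕ} {d : Fin M → Fin N → ℕ} {h : ∀ k j, Matrix (Fin (d k j)) (Fin (d k j)) ℂ}
  {ι κ : Type} [Fintype ι]

lemma exists_isUnitVector_sqrt_smul [DecidableEq ι] [Nonempty ι] (v : ι → ℂ) :
    ∃ ψ : ι → ℂ, IsUnitVector ψ ∧ v = (√(∑ i, ‖v i‖ ^ 2) : ℂ) • ψ := by
  set p := ∑ i, ‖v i‖ ^ 2 with hp
  have hp0 : 0 ≤ p := by positivity
  rcases hp0.eq_or_lt with h0 | h0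
  · refine ⟨Pi.single (Classical.arbitrary ι) 1, ?_, ?_⟩
    · rw [IsUnitVector, Finset.sum_eq_single (Classical.arbitrary ι)] <;> simp +contextual
    · have hv : ∀ i, ‖v i‖ ^ 2 = 0 := fun i =>
        (Finset.sum_eq_zero_iff_of_nonneg fun i _ => by positivity).1 (hp.symm.trans h0.symm) i
          (Finset.mem_univ i)
      rw [← h0]
      ext i
      simpa using hv i
  · have hs : (√p : ℂ) ≠ 0 := by simpa using (Real.sqrt_pos.2 h0).ne'
    refine ⟨(√p : ℂ)⁻¹ • v, ?_, by rw [smul_inv_smul₀ hs]⟩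
    simp only [IsUnitVector, Pi.smul_apply, norm_smul, mul_pow, ← Finset.mul_sum, norm_inv,
      Complex.norm_real, Real.norm_eq_abs, inv_pow, sq_abs, Real.sq_sqrt hp0]
    exact inv_mul_cancel₀ h0.ne'

variable [DecidableEq ι]

/-- Squared norms serve as the probabilities, and unit trace makes them sum to one. A zero vector
becomes an arbitrary unit vector of weight zero, which exists since unit trace excludes an empty
basis. -/
lemma mem_roofValues_of_eq_sum {α : Type} [Fintype α] {ρ : Matrix ι ι ℂ} (ht : ρ.trace = 1)
    {v : α → ι → ℂ} (hv : ρ = ∑ i, pureState (v i)) :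
    ∑ i, pureCoherence h (v i) ∈ roofValues h ρ := by
  have : Nonempty ι := by
    by_contra hne
    rw [not_nonempty_iff] at hne
    simp [Matrix.trace] at ht
  let e := (Fintype.equivFin α).symm
  choose ψ hψ hvψ using fun i => exists_isUnitVector_sqrt_smul (v i)
  have hp : ∀ i, 0 ≤ ∑ x, ‖v i x‖ ^ 2 := fun i => by positivity
  refine ⟨Fintype.card α, fun n => ∑ x, ‖v (e n) x‖ ^ 2, fun n => ψ (e n), fun n => hp _, ?_,
    fun n => hψ _, ?_, ?_⟩
  · have h1 : ((∑ i, ∑ x, ‖v i x‖ ^ 2 : ℝ) : ℂ) = 1 := by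
      rw [← ht, hv, Matrix.trace_sum, Complex.ofReal_sum]
      simp only [trace_pureState]
    rw [e.sum_comp fun i => ∑ x, ‖v i x‖ ^ 2]
    exact_mod_cast h1
  · rw [hv, ← e.sum_comp]
    refine Finset.sum_congr rfl fun n _ => ?_
    rw [← pureState_sqrt_smul (hp _), ← hvψ]
  · rw [← e.sum_comp]
    refine Finset.sum_congr rfl fun n _ => ?_
    rw [← pureCoherence_sqrt_smul (hp _), ← hvψ]

lemma exists_eq_sum_of_mem_roofValues {ρ : Matrix ι ι ℂ} {c : ℝ} (hc : c ∈ roofValues h ρ) :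
    ∃ (m : ℕ) (v : Fin m → ι → ℂ), ρ = ∑ i, pureState (v i) ∧
      c = ∑ i, pureCoherence h (v i) := by
  obtain ⟨m, p, ψ, hp, -, -, hρ, hc⟩ := hc
  refine ⟨m, fun i => (√(p i) : ℂ) • ψ i, ?_, ?_⟩
  · simp only [pureState_sqrt_smul (hp _), hρ]
  · simp only [pureCoherence_sqrt_smul (hp _), hc]

lemma nonneg_of_mem_roofValues {ρ : Matrix ι ι ℂ} {c : ℝ} (hc : c ∈ roofValues h ρ) : 0 ≤ c := by
  obtain ⟨m, v, -, rfl⟩ := exists_eq_sum_of_mem_roofValues hc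
  exact Finset.sum_nonneg fun i _ => pureCoherence_nonneg _

lemma bddBelow_roofValues (ρ : Matrix ι ι ℂ) : BddBelow (roofValues h ρ) :=
  ⟨0, fun _ => nonneg_of_mem_roofValues⟩

lemma nonempty_roofValues {ρ : Matrix ι ι ℂ} (hρ : IsDensity ρ) : (roofValues h ρ).Nonempty := by
  obtain ⟨v, hv⟩ := exists_eq_sum_pureState hρ.1
  exact ⟨_, mem_roofValues_of_eq_sum hρ.2 hv⟩

lemma isGLB_distributedQFICoherence {ρ : Matrix ι ι ℂ} (hρ : IsDensity ρ) :
    IsGLB (roofValues h ρ) (distributedQFICoherence h ι ρ) :=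
  isGLB_csInf (nonempty_roofValues hρ) (bddBelow_roofValues ρ)

lemma distributedQFICoherence_nonneg (ρ : Matrix ι ι ℂ) : 0 ≤ distributedQFICoherence h ι ρ :=
  Real.sInf_nonneg fun _ => nonneg_of_mem_roofValues

lemma distributedQFICoherence_le {α : Type} [Fintype α] {ρ : Matrix ι ι ℂ} (ht : ρ.trace = 1)
    {v : α → ι → ℂ} (hv : ρ = ∑ i, pureState (v i)) :
    distributedQFICoherence h ι ρ ≤ ∑ i, pureCoherence h (v i) :=
  csInf_le (bddBelow_roofValues ρ) (mem_roofValues_of_eq_sum ht hv)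

lemma le_distributedQFICoherence {ρ : Matrix ι ι ℂ} (hρ : IsDensity ρ) {c : ℝ}
    (hc : ∀ (m : ℕ) (v : Fin m → ι → ℂ), ρ = ∑ i, pureState (v i) →
      c ≤ ∑ i, pureCoherence h (v i)) : c ≤ distributedQFICoherence h ι ρ := by
  refine le_csInf (nonempty_roofValues hρ) fun b hb => ?_
  obtain ⟨m, v, hv, rfl⟩ := exists_eq_sum_of_mem_roofValues hb
  exact hc m v hv

/-- Nearly optimal decompositions of the two states, rescaled and joined, decompose the mixture. -/
lemma distributedQFICoherence_convex {ρ σ : Matrix ι ι ℂ} (hρ : IsDensity ρ) (hσ : IsDensity σ)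
    {s t : ℝ} (hs : 0 ≤ s) (ht : 0 ≤ t) (hst : s + t = 1) :
    distributedQFICoherence h ι (s • ρ + t • σ) ≤
      s * distributedQFICoherence h ι ρ + t * distributedQFICoherence h ι σ := by
  refine le_of_forall_pos_le_add fun ε hε => ?_
  obtain ⟨a, ha, haε⟩ := exists_lt_of_csInf_lt (nonempty_roofValues (h := h) hρ)
    (lt_add_of_pos_right _ hε)
  obtain ⟨b, hb, hbε⟩ := exists_lt_of_csInf_lt (nonempty_roofValues (h := h) hσ)
    (lt_add_of_pos_right _ hε)
  obtain ⟨m, v, hv, rfl⟩ := exists_eq_sum_of_mem_roofValues ha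
  obtain ⟨m', u, hu, rfl⟩ := exists_eq_sum_of_mem_roofValues hb
  have htr : (s • ρ + t • σ).trace = 1 := by
    rw [Matrix.trace_add, Matrix.trace_smul, Matrix.trace_smul, hρ.2, hσ.2, ← add_smul, hst,
      one_smul]
  have key := distributedQFICoherence_le (h := h) htr
    (v := Sum.elim (fun i => (√s : ℂ) • v i) fun i => (√t : ℂ) • u i) (by
      simp only [Fintype.sum_sum_type, Sum.elim_inl, Sum.elim_inr, pureState_sqrt_smul hs,
        pureState_sqrt_smul ht, ← Finset.smul_sum, ← hv, ← hu])
  simp only [Fintype.sum_sum_type, Sum.elim_inl, Sum.elim_inr, pureCoherence_sqrt_smul hs,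
    pureCoherence_sqrt_smul ht, ← Finset.mul_sum] at key
  change _ < distributedQFICoherence h ι ρ + ε at haε
  change _ < distributedQFICoherence h ι σ + ε at hbε
  have h1 := mul_le_mul_of_nonneg_left haε.le hs
  have h2 := mul_le_mul_of_nonneg_left hbε.le ht
  have h3 : s * ε + t * ε = ε := by rw [← add_mul, hst, one_mul]
  linarith

variable [Fintype κ] [DecidableEq κ]

/-- The vectors `K n *ᵥ v i` over all pairs `(n, i)` decompose `Φ ρ`; for fixed `i`, pure-state
strong monotonicity bounds the sum over `n`. -/
lemma distributedQFICoherence_monotone (hd : ∀ k j, (h k j).IsDiag) (k₀ : Fin M)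
    (b : ∀ k, Particles (d k)) {Φ : Matrix ι ι ℂ →ₗ[ℂ] Matrix κ κ ℂ}
    (hΦ : IsIncoherentOperation Φ) {ρ : Matrix ι ι ℂ} (hρ : IsDensity ρ) :
    distributedQFICoherence h κ (Φ ρ) ≤ distributedQFICoherence h ι ρ := by
  have htr : (Φ ρ).trace = 1 := (hΦ.trace_eq ρ).trans hρ.2
  obtain ⟨r, K, hK, hKΦ⟩ := hΦ
  refine le_distributedQFICoherence hρ fun m v hv => ?_
  refine (distributedQFICoherence_le htr
    (v := fun q : Fin r × Fin m => K q.1 *ᵥ v q.2) ?_).trans ?_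
  · rw [hKΦ, hv, Fintype.sum_prod_type]
    simp only [sum_pureState_conj]
  · rw [Fintype.sum_prod_type_right]
    exact Finset.sum_le_sum fun i _ => sum_pureCoherence_le hd k₀ b hK (v i)

lemma distributedQFICoherence_strongMonotone (hd : ∀ k j, (h k j).IsDiag) (k₀ : Fin M)
    (b : ∀ k, Particles (d k)) {r : ℕ} {K : Fin r → Matrix κ ι ℂ} (hK : IsIncoherentKraus K)
    {ρ : Matrix ι ι ℂ} (hρ : IsDensity ρ) :
    ∑ n, (K n * ρ * (K n)ᴴ).trace.re * distributedQFICoherence h κ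
      (((K n * ρ * (K n)ᴴ).trace.re)⁻¹ • (K n * ρ * (K n)ᴴ)) ≤
      distributedQFICoherence h ι ρ := by
  refine le_distributedQFICoherence hρ fun m v hv => ?_
  calc _ ≤ ∑ n, ∑ i, pureCoherence h (K n *ᵥ v i) := ?_
    _ = ∑ i, ∑ n, pureCoherence h (K n *ᵥ v i) := Finset.sum_comm
    _ ≤ _ := Finset.sum_le_sum fun i _ => sum_pureCoherence_le hd k₀ b hK (v i)
  refine Finset.sum_le_sum fun n _ => ?_
  have htn := Complex.le_def.1 (hρ.1.mul_mul_conjTranspose_same (K n)).trace_nonneg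
  set p := (K n * ρ * (K n)ᴴ).trace.re with hp
  have hp0 : 0 ≤ p := htn.1
  -- For an outcome of probability zero the normalized matrix is not a state, but its weight removes
  -- the term.
  rcases hp0.eq_or_lt with h0 | h0
  · rw [← h0, zero_mul]
    exact Finset.sum_nonneg fun i _ => pureCoherence_nonneg _
  · have htr : (p⁻¹ • (K n * ρ * (K n)ᴴ)).trace = 1 := by
      have : (K n * ρ * (K n)ᴴ).trace = (p : ℂ) := Complex.ext rfl htn.2.symm
      rw [Matrix.trace_smul, this, Complex.real_smul, ← Complex.ofReal_mul,
        inv_mul_cancel₀ h0.ne', Complex.ofReal_one]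
    have hi : 0 ≤ p⁻¹ := inv_nonneg.2 hp0
    have key := distributedQFICoherence_le (h := h) htr
      (v := fun i => (√p⁻¹ : ℂ) • K n *ᵥ v i) (by
        simp only [pureState_sqrt_smul hi, ← Finset.smul_sum]
        rw [hv, sum_pureState_conj])
    simp only [pureCoherence_sqrt_smul hi, ← Finset.mul_sum] at key
    calc _ ≤ p * (p⁻¹ * ∑ i, pureCoherence h (K n *ᵥ v i)) :=
          mul_le_mul_of_nonneg_left key hp0
      _ = _ := mul_inv_cancel_left₀ h0.ne' _

lemma distributedQFICoherence_eq_zero (hd : ∀ k j, (h k j).IsDiag) {ρ : Matrix ι ι ℂ}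
    (hρ : IsIncoherentState ρ) : distributedQFICoherence h ι ρ = 0 := by
  refine le_antisymm ?_ (distributedQFICoherence_nonneg ρ)
  have hps : ∀ i : ι, pureState (Pi.single i 1 : ι → ℂ) = Matrix.single i i 1 := by
    intro i
    ext x y
    simp only [pureState, Matrix.vecMulVec_apply, Matrix.single_apply, Pi.star_apply,
      Pi.single_apply, eq_comm (b := i)]
    by_cases hx : i = x <;> by_cases hy : i = y <;> simp [hx, hy]
  have hre := fun i => Complex.le_def.1 (hρ.1.1.diag_nonneg (i := i))
  refine (distributedQFICoherence_le hρ.1.2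
    (v := fun i => (√(ρ i i).re : ℂ) • Pi.single i 1) ?_).trans_eq ?_
  · conv_lhs => rw [← hρ.2.diagonal_diag, ← Matrix.sum_single_eq_diagonal]
    refine Finset.sum_congr rfl fun i _ => ?_
    have : ρ i i = ((ρ i i).re : ℂ) := Complex.ext rfl (hre i).2.symm
    rw [pureState_sqrt_smul (hre i).1, hps, Matrix.smul_single, Complex.real_smul, mul_one, ← this,
      Matrix.diag_apply]
  · refine Finset.sum_eq_zero fun i _ => ?_
    rw [pureCoherence_sqrt_smul (hre i).1, pureCoherence_eq_zero hd, mul_zero]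
    rw [hps, ← Matrix.diagonal_single]
    exact Matrix.isDiag_diagonal _

/-- The off-diagonal entries of a state bound its coherence from below. -/
lemma le_distributedQFICoherence_of_ne (hd : ∀ k j, (h k j).IsDiag) (k₀ : Fin M)
    (b : ∀ k, Particles (d k)) (x y : Particles (d k₀)) {ρ : Matrix ι ι ℂ} (hρ : IsDensity ρ)
    {i j : ι} (hij : i ≠ j) :
    ‖ρ i j‖ ^ 2 * ‖energy (h k₀) x - energy (h k₀) y‖ ^ 2 ≤ distributedQFICoherence h ι ρ := by
  refine le_csInf (nonempty_roofValues hρ) ?_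
  rintro _ ⟨m, p, ψ, hp, hp1, hψ, hρψ, rfl⟩
  have h1 : ‖ρ i j‖ ≤ ∑ n, p n * ‖pureState (ψ n) i j‖ := by
    rw [hρψ, Matrix.sum_apply]
    refine (norm_sum_le _ _).trans_eq (Finset.sum_congr rfl fun n _ => ?_)
    rw [Matrix.smul_apply, norm_smul, Real.norm_of_nonneg (hp n)]
  -- Jensen's inequality for the square carries the pure-state bound over to mixtures.
  have h2 : ‖ρ i j‖ ^ 2 ≤ ∑ n, p n * ‖pureState (ψ n) i j‖ ^ 2 :=
    (pow_le_pow_left₀ (norm_nonneg _) h1 2).trans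
      (Real.pow_arith_mean_le_arith_mean_pow _ _ _ (fun n _ => hp n) hp1
        (fun n _ => norm_nonneg _) 2)
  calc _ ≤ (∑ n, p n * ‖pureState (ψ n) i j‖ ^ 2) *
        ‖energy (h k₀) x - energy (h k₀) y‖ ^ 2 := by gcongr
    _ = ∑ n, p n * (‖pureState (ψ n) i j‖ ^ 2 *
        ‖energy (h k₀) x - energy (h k₀) y‖ ^ 2) := by
      rw [Finset.sum_mul]; simp only [mul_assoc]
    _ ≤ _ := Finset.sum_le_sum fun n _ =>
      mul_le_mul_of_nonneg_left (le_pureCoherence hd k₀ b x y (hψ n) hij) (hp n)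

end roof

lemma exists_diag_ne_of_ne_smul_one {n : ℕ} {A : Matrix (Fin n) (Fin n) ℂ} (hA : A.IsDiag)
    (hne : ∀ c : ℂ, A ≠ c • 1) : ∃ x y, A x x ≠ A y y := by
  by_contra! hall
  have key : ∀ c : ℂ, (∀ x, A x x = c) → A = c • 1 := by
    intro c hc
    ext x y
    by_cases hxy : x = y
    · subst hxy; simp [hc]
    · simp [hA hxy, hxy]
  -- In dimension zero every matrix equals `0 • 1`, so non-triviality also rules out empty particle
  -- spaces.
  rcases isEmpty_or_nonempty (Fin n) with _ | ⟨⟨x⟩⟩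
  · exact hne 0 (key 0 fun x => isEmptyElim x)
  · exact hne _ (key (A x x) fun y => hall y x)

end CoherenceQFI

theorem theorem1 (M N : ℕ) (hM : 1 ≤ M) (hN : 1 ≤ N) (d : Fin M → Fin N → ℕ)
    (h : ∀ k j, Matrix (Fin (d k j)) (Fin (d k j)) ℂ)
    (h_herm : ∀ k j, (h k j).IsHermitian)
    (h_basis : ∀ k j, (h k j).IsDiag)
    (h_nontrivial : ∀ k j, ∀ c : ℂ, h k j ≠ c • (1 : Matrix (Fin (d k j)) (Fin (d k j)) ℂ)) :
    (∀ (ι : Type) [Fintype ι] [DecidableEq ι] (ψ : ι → ℂ), CoherenceQFI.IsUnitVector ψ →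
      IsLUB (CoherenceQFI.pureValues h ψ) (CoherenceQFI.pureCoherence h ψ)) ∧
    (∀ (ι : Type) [Fintype ι] [DecidableEq ι] (ρ : Matrix ι ι ℂ), CoherenceQFI.IsDensity ρ →
      IsGLB (CoherenceQFI.roofValues h ρ) (CoherenceQFI.distributedQFICoherence h ι ρ)) ∧
    CoherenceQFI.IsCoherenceMeasure
      (fun ι _ _ => CoherenceQFI.distributedQFICoherence h ι) := by
  choose x y hxy using fun k j =>
    CoherenceQFI.exists_diag_ne_of_ne_smul_one (h_basis k j) (h_nontrivial k j)
  let k₀ : Fin M := ⟨0, hM⟩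
  let j₀ : Fin N := ⟨0, hN⟩
  -- Changing a single particle between levels with distinct eigenvalues changes the total energy.
  -- The labels `x` also serve as the reference configuration of all partitions.
  have hE : CoherenceQFI.energy (h k₀) (x k₀) ≠
      CoherenceQFI.energy (h k₀) (Function.update (x k₀) j₀ (y k₀ j₀)) := by
    rw [← sub_ne_zero, ← neg_ne_zero, neg_sub, CoherenceQFI.energy_update_sub, sub_ne_zero]
    exact (hxy k₀ j₀).symm
  refine ⟨fun ι _ _ ψ _ => CoherenceQFI.isLUB_pureCoherence h_basis k₀ x ψ,
    fun ι _ _ ρ hρ => CoherenceQFI.isGLB_distributedQFICoherence hρ, ?_⟩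
  refine
    { nonneg := fun ι _ _ ρ _ => CoherenceQFI.distributedQFICoherence_nonneg ρ
      faithful := fun ι _ _ ρ hρ => ⟨fun h0 => ⟨hρ, fun i j hij => ?_⟩,
        CoherenceQFI.distributedQFICoherence_eq_zero h_basis⟩
      monotone := fun ι κ _ _ _ _ Φ ρ hΦ hρ =>
        CoherenceQFI.distributedQFICoherence_monotone h_basis k₀ x hΦ hρ
      strongMonotone := fun ι κ _ _ _ _ r K ρ hK hρ =>
        CoherenceQFI.distributedQFICoherence_strongMonotone h_basis k₀ x hK hρ
      convex := fun ι _ _ ρ σ t hρ hσ h0 h1 =>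
        CoherenceQFI.distributedQFICoherence_convex hρ hσ h0 (sub_nonneg.2 h1)
          (add_sub_cancel t 1) }
  have hle := CoherenceQFI.le_distributedQFICoherence_of_ne h_basis k₀ x (x k₀)
    (Function.update (x k₀) j₀ (y k₀ j₀)) hρ hij
  rw [h0] at hle
  have hpos : 0 < ‖CoherenceQFI.energy (h k₀) (x k₀) -
      CoherenceQFI.energy (h k₀) (Function.update (x k₀) j₀ (y k₀ j₀))‖ ^ 2 :=
    pow_pos (norm_pos_iff.2 (sub_ne_zero.2 hE)) 2
  have hz : ‖ρ i j‖ ^ 2 ≤ 0 := nonpos_of_mul_nonpos_left hle hpos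
  exact norm_eq_zero.1 (pow_eq_zero_iff two_ne_zero |>.1 (le_antisymm hz (sq_nonneg _)))
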